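/- Let $d\ge 0$ be an integer and $n=\lfloor d/2\rfloor$. For $a\in\mathbb R$ and $\lambda=(\lambda_1,\dots,\lambda_d)\in\mathbb R^d$ consider the Liénard system in the real plane $$\dot x=y,\qquad \dot y=-x+\Bigl(a+\sum_{i=1}^{d}\lambda_i x^i\Bigr)y. \tag{$L_{a,\lambda}$}$$ A limit cycle of this system is an isolated periodic orbit: a nonconstant periodic orbit $\Gamma$ having a neighborhood that contains no periodic orbit other than $\Gamma$. (1) (Linear part a center, $a=0$.) For every $\lambda\in\mathbb R^d$ there are a neighborhood $U$ of the origin in $\mathbb R^2$ and a neighborhood $W$ of $\lambda$ in $\mathbb R^d$ such that for every $\mu\in W$ the system $(L_{0,\mu})$ has at most $\max(n-1,0)$ limit cycles contained in $U$. (2) (Linear part perturbed to a focus.) For every $a\in\mathbb R$ (in particular for $a=0$, which covers all small perturbations of the linear center into a focus) and every $\lambda\in\mathbb R^d$ there are a neighborhood $U$ of the origin in $\mathbb R^2$ and a neighborhood $W$ of $(a,\lambda)$ in $\mathbb R\times\mathbb R^d$ such that for every $(b,\mu)\in W$ the system $(L_{b,\mu})$ has at most $n$ limit cycles contained in $U$.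 -/

import Mathlib

open Filter Topology

/-- The Liénard vector field on the real plane with parameters `a` and `lam`: writing
`lam i = λ_{i+1}` for `i = 0, …, d - 1`, it is the right-hand side of
`x' = y`, `y' = -x + (a + λ_1 x + λ_2 x ^ 2 + ⋯ + λ_d x ^ d) y`.
For `a = 0` the linear part at the origin is the linear center `x' = y`, `y' = -x`;
for `0 < |a| < 2` it is a focus. -/
def lienardField {d : ℕ} (a : ℝ) (lam : Fin d → ℝ) (z : ℝ × ℝ) : ℝ × ℝ :=
  (z.2, -z.1 + (a + ∑ i : Fin d, lam i * z.1 ^ ((i : ℕ) + 1)) * z.2)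

/-- `Γ` is a (nontrivial) periodic orbit of the planar autonomous system `z' = X z`: the image of
a nonconstant periodic solution defined for all times. -/
def IsPeriodicOrbit (X : ℝ × ℝ → ℝ × ℝ) (Γ : Set (ℝ × ℝ)) : Prop :=
  ∃ γ : ℝ → ℝ × ℝ, IsIntegralCurve γ (fun _ => X) ∧
    (∃ T : ℝ, 0 < T ∧ Function.Periodic γ T) ∧
    (∃ s t : ℝ, γ s ≠ γ t) ∧ Γ = Set.range γ

/-- A limit cycle is an isolated periodic orbit: some open set containing it contains no other
periodic orbit. -/
def IsLimitCycle (X : ℝ × ℝ → ℝ × ℝ) (Γ : Set (ℝ × ℝ)) : Prop :=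
  IsPeriodicOrbit X Γ ∧
    ∃ V : Set (ℝ × ℝ), IsOpen V ∧ Γ ⊆ V ∧
      ∀ Γ' : Set (ℝ × ℝ), IsPeriodicOrbit X Γ' → Γ' ⊆ V → Γ' = Γ

/-- The set of limit cycles of `X` that lie entirely in `U`. -/
def limitCyclesIn (X : ℝ × ℝ → ℝ × ℝ) (U : Set (ℝ × ℝ)) : Set (Set (ℝ × ℝ)) :=
  {Γ : Set (ℝ × ℝ) | IsLimitCycle X Γ ∧ Γ ⊆ U}

open Real Set
open scoped ContDiff BoundedContinuousFunction Manifold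

/-!
In the coordinates logarithmic radius and angle the field is `2π`-periodic in the angle, and a
closed orbit in a small disc is a periodic graph over the angle. Rescaling an orbit by `exp t`
multiplies the coefficient of `x ^ k` in the damping by `exp (k * t)`, so orbits of small radius are
orbits of radius about `1` for small coefficients. There, the implicit function theorem in
a space of bounded functions shows that the half turn from angle `0` to angle `π` depends
analytically on the coefficients `p`.

The reflection `(x, t) ↦ (-x, -t)` turns the half turn from `0` back to `-π` into a forward half
turn for the coefficients `(-1) ^ (k + 1) * p k`. An orbit is closed when both half turns end at the
same radius, and the difference of the two is a combination `∑ p k * Ψ k p` over the even `k`,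
where `Ψ k 0` is a multiple of `∫ sin ^ k * cos ^ 2 > 0`. Along `p k = c k * exp (k * t)`,
alternately dividing by one term and differentiating, Rolle's theorem bounds the number of zeros by
the number of nonzero even coefficients minus one, uniformly in the coefficients. When all even
coefficients vanish the system is reversible and the closed orbits form a continuum, none of them
isolated. If `a ≠ 0` the function `a * (x ^ 2 + y ^ 2)` is monotone along small orbits, so there
are no closed ones.
-/

theorem encard_zeros_le_encard_zeros_deriv_add_one {J : Set ℝ} (hJ : J.OrdConnected)
    {f f' : ℝ → ℝ} (hf : ∀ t ∈ J, HasDerivAt f (f' t) t) :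
    {t ∈ J | f t = 0}.encard ≤ {t ∈ J | f' t = 0}.encard + 1 := by
  refine ENat.forall_natCast_le_iff_le.1 fun n hn => ?_
  obtain _ | n := n
  · simp
  obtain ⟨Z, hZ, hZn⟩ := exists_subset_encard_eq hn
  lift Z to Finset ℝ using finite_of_encard_eq_coe hZn
  rw [encard_coe_eq_coe_finsetCard, Nat.cast_inj] at hZn
  let z := Z.orderEmbOfFin hZn
  have hz (i) : z i ∈ J ∧ f (z i) = 0 := hZ (Z.orderEmbOfFin_mem hZn i)
  have hzJ (i : Fin n) : Icc (z i.castSucc) (z i.succ) ⊆ J := hJ.out (hz _).1 (hz _).1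
  have rolle (i : Fin n) : ∃ x ∈ Ioo (z i.castSucc) (z i.succ), f' x = 0 :=
    exists_hasDerivAt_eq_zero (z.strictMono Fin.castSucc_lt_succ)
      (fun x hx => (hf x (hzJ i hx)).continuousAt.continuousWithinAt)
      ((hz _).2.trans (hz _).2.symm) (fun x hx => hf x (hzJ i (Ioo_subset_Icc_self hx)))
  choose w hw hw₀ using rolle
  have hw_mono : StrictMono w := fun i j hij =>
    (hw i).2.trans_le ((z.monotone (Fin.succ_le_castSucc_iff.2 hij)).trans (hw j).1.le)
  calc ((n + 1 : ℕ) : ℕ∞) = (range w).encard + 1 := by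
        rw [← image_univ, hw_mono.injective.encard_image]; simp
    _ ≤ {t ∈ J | f' t = 0}.encard + 1 := by
        gcongr
        rintro _ ⟨i, rfl⟩
        exact ⟨hzJ i (Ioo_subset_Icc_self (hw i)), hw₀ i⟩

section DivisionDerivation

variable {P κ : Type*} [NormedAddCommGroup P] [NormedSpace ℝ P] {X : P → P} {p₀ : P}
  {Φ : P → ℝ}

/-- The operator `a + X`, where the vector field `X` acts as a derivation: it describes the
derivative of `t ↦ exp (a * t) * Φ (y t)` along the trajectories `y` of `X`. -/
noncomputable def twistedLieDeriv (a : ℝ) (X : P → P) (Φ : P → ℝ) (p : P) : ℝ :=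
  a * Φ p + fderiv ℝ Φ p (X p)

theorem twistedLieDeriv_of_eq_zero (a : ℝ) (hX₀ : X p₀ = 0) :
    twistedLieDeriv a X Φ p₀ = a * Φ p₀ := by
  simp [twistedLieDeriv, hX₀]

theorem contDiffAt_twistedLieDeriv (a : ℝ) (hX : ContDiffAt ℝ ∞ X p₀)
    (hΦ : ContDiffAt ℝ ∞ Φ p₀) : ContDiffAt ℝ ∞ (twistedLieDeriv a X Φ) p₀ :=
  (contDiffAt_const.mul hΦ).add ((hΦ.fderiv_right (m := ∞) (by simp)).clm_apply hX)

theorem hasDerivAt_exp_mul_comp (a : ℝ) {y : ℝ → P} {t : ℝ} (hΦ : DifferentiableAt ℝ Φ (y t))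
    (hy : HasDerivAt y (X (y t)) t) :
    HasDerivAt (fun t => exp (a * t) * Φ (y t))
      (exp (a * t) * twistedLieDeriv a X Φ (y t)) t := by
  refine ((hasDerivAt_const_mul a).exp.mul (hΦ.hasFDerivAt.comp_hasDerivAt t hy)).congr_deriv ?_
  simp only [twistedLieDeriv, Function.comp_apply]
  ring

theorem sum_cons_mul_exp (c e w : κ → ℝ) (t : ℝ) {I : Finset κ} {j : κ} (hj : j ∉ I)
    (hw : w j ≠ 0) :
    ∑ i ∈ I.cons j hj, c i * (exp (e i * t) * w i) =
      exp (e j * t) * w j * (c j + ∑ i ∈ I, c i * (exp ((e i - e j) * t) * (w i / w j))) := by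
  rw [Finset.sum_cons, mul_add, Finset.mul_sum]
  congr 1
  · ring
  · refine Finset.sum_congr rfl fun i _ => ?_
    rw [sub_mul, exp_sub]
    field_simp

theorem encard_zeros_sum_cons_le {y : ℝ → P} {J : Set ℝ} (hJ : J.OrdConnected)
    (hy : ∀ t ∈ J, HasDerivAt y (X (y t)) t) (c e : κ → ℝ) {Ψ : κ → P → ℝ} {I : Finset κ} {j : κ}
    (hj : j ∉ I) (hΨj : ∀ t ∈ J, Ψ j (y t) ≠ 0)
    (hdiff : ∀ t ∈ J, ∀ i ∈ I, DifferentiableAt ℝ (fun p => Ψ i p / Ψ j p) (y t)) :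
    {t ∈ J | ∑ i ∈ I.cons j hj, c i * (exp (e i * t) * Ψ i (y t)) = 0}.encard ≤
      {t ∈ J | ∑ i ∈ I, c i * (exp ((e i - e j) * t) *
        twistedLieDeriv (e i - e j) X (fun p => Ψ i p / Ψ j p) (y t)) = 0}.encard + 1 := by
  -- Dividing by the `j`-th term makes it constant, so that differentiating removes it.
  let f (t : ℝ) : ℝ := c j + ∑ i ∈ I, c i * (exp ((e i - e j) * t) * (Ψ i (y t) / Ψ j (y t)))
  have hf : ∀ t ∈ J, HasDerivAt f (∑ i ∈ I, c i * (exp ((e i - e j) * t) *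
      twistedLieDeriv (e i - e j) X (fun p => Ψ i p / Ψ j p) (y t))) t := fun t ht =>
    .const_add _ <| .fun_sum fun i hi =>
      (hasDerivAt_exp_mul_comp _ (hdiff t ht i hi) (hy t ht)).const_mul _
  have hzeros : {t ∈ J | ∑ i ∈ I.cons j hj, c i * (exp (e i * t) * Ψ i (y t)) = 0} =
      {t ∈ J | f t = 0} := Set.ext fun t => and_congr_right fun ht => by
    rw [sum_cons_mul_exp c e (fun i => Ψ i (y t)) t hj (hΨj t ht), mul_eq_zero,
      or_iff_right (mul_ne_zero (exp_pos _).ne' (hΨj t ht))]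
  rw [hzeros]
  exact encard_zeros_le_encard_zeros_deriv_add_one hJ hf

theorem eventually_encard_zeros_lt_card (hX : ContDiffAt ℝ ∞ X p₀) (hX₀ : X p₀ = 0)
    {I : Finset κ} (hI : I.Nonempty) {e : κ → ℝ} (he : InjOn e I) {Ψ : κ → P → ℝ}
    (hΨ : ∀ i ∈ I, ContDiffAt ℝ ∞ (Ψ i) p₀) (hΨ₀ : ∀ i ∈ I, Ψ i p₀ ≠ 0) :
    ∀ᶠ V in (𝓝 p₀).smallSets, ∀ (y : ℝ → P) (J : Set ℝ) (c : κ → ℝ), J.OrdConnected →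
      (∀ t ∈ J, HasDerivAt y (X (y t)) t) → MapsTo y J V → (∀ i ∈ I, c i ≠ 0) →
      {t ∈ J | ∑ i ∈ I, c i * (exp (e i * t) * Ψ i (y t)) = 0}.encard < I.card := by
  induction hI using Finset.Nonempty.cons_induction generalizing e Ψ with
  | singleton j =>
    simp only [Finset.mem_singleton, forall_eq] at hΨ hΨ₀
    have hV := hΨ.continuousAt.eventually_ne hΨ₀
    filter_upwards [hV.smallSets] with V hV y J c _ _ hyV hc
    simp only [Finset.sum_singleton, Finset.card_singleton, Nat.cast_one, Order.lt_one_iff,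
      encard_eq_zero]
    exact eq_empty_of_forall_notMem fun t ht =>
      mul_ne_zero (hc j (Finset.mem_singleton_self j))
        (mul_ne_zero (exp_pos _).ne' (hV _ (hyV ht.1))) ht.2
  | cons j I hj _ ih =>
    simp only [Finset.mem_cons, forall_eq_or_imp] at hΨ hΨ₀
    let Φ (i : κ) (p : P) : ℝ := Ψ i p / Ψ j p
    have hΦ : ∀ i ∈ I, ContDiffAt ℝ ∞ (Φ i) p₀ := fun i hi => (hΨ.2 i hi).div hΨ.1 hΨ₀.1
    have hne : ∀ i ∈ I, twistedLieDeriv (e i - e j) X (Φ i) p₀ ≠ 0 := fun i hi => by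
      rw [twistedLieDeriv_of_eq_zero _ hX₀]
      refine mul_ne_zero (sub_ne_zero.2 fun hij => ?_) (div_ne_zero (hΨ₀.2 i hi) hΨ₀.1)
      exact hj (he (by simp [hi]) (by simp) hij ▸ hi)
    have ih := ih (e := fun i => e i - e j) (Ψ := fun i => twistedLieDeriv (e i - e j) X (Φ i))
      (fun a ha b hb hab => he (by simp_all) (by simp_all) (sub_left_injective hab))
      (fun i hi => contDiffAt_twistedLieDeriv _ hX (hΦ i hi)) hne
    have hdiff : ∀ᶠ p in 𝓝 p₀, ∀ i ∈ I, DifferentiableAt ℝ (Φ i) p :=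
      (Finset.eventually_all I).2 fun i hi =>
        (((hΦ i hi).of_le (m := 1) (by simp)).eventually (by simp)).mono fun p hp =>
          hp.differentiableAt (by simp)
    filter_upwards [ih, (hΨ.1.continuousAt.eventually_ne hΨ₀.1).smallSets, hdiff.smallSets]
      with V ih hV₀ hV y J c hJ hy hyV hc
    rw [Finset.card_cons, Nat.cast_add_one]
    refine (encard_zeros_sum_cons_le hJ hy c e hj (fun t ht => hV₀ _ (hyV ht))
      fun t ht => hV _ (hyV ht)).trans_lt ?_
    exact (ENat.add_lt_add_iff_right ENat.one_ne_top).2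
      (ih y J c hJ hy hyV fun i hi => hc i (Finset.mem_cons_of_mem hi))

end DivisionDerivation

section ParametricIntegral

universe u

variable {P : Type u} [NormedAddCommGroup P] [NormedSpace ℝ P]

theorem hasFDerivAt_intervalIntegral {F : Type*} [NormedAddCommGroup F] [NormedSpace ℝ F]
    [CompleteSpace F] {f : P × ℝ → F} {a b : ℝ} {p : P}
    (hf : ∀ t ∈ uIcc a b, ContDiffAt ℝ 1 f (p, t)) :
    HasFDerivAt (fun p => ∫ t in a..b, f (p, t))
      (∫ t in a..b, fderiv ℝ f (p, t) ∘L .inl ℝ P ℝ) p := by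
  let f' (x : P) (t : ℝ) : P →L[ℝ] F := fderiv ℝ f (x, t) ∘L .inl ℝ P ℝ
  have hf'_cont (t) (ht : t ∈ uIcc a b) : ContinuousAt (fun q : P × ℝ => f' q.1 q.2) (p, t) :=
    ((hf t ht).fderiv_right (m := 0) (by simp)).continuousAt.clm_comp continuousAt_const
  have hslice : ContinuousOn (f' p) (uIcc a b) := fun t ht =>
    ((hf'_cont t ht).comp (by fun_prop : ContinuousAt (Prod.mk p) t)).continuousWithinAt
  obtain ⟨C, hC⟩ := isCompact_uIcc.exists_bound_of_continuousOn hslice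
  have hnear : ∀ᶠ x in 𝓝 p, ∀ t ∈ uIcc a b, ContDiffAt ℝ 1 f (x, t) ∧ ‖f' x t‖ < C + 1 :=
    isCompact_uIcc.eventually_forall_of_forall_eventually fun t ht =>
      ((hf t ht).eventually (by simp)).and
        ((hf'_cont t ht).norm.eventually_lt_const ((hC t ht).trans_lt (lt_add_one C)))
  have hcont {x} (hx : ∀ t ∈ uIcc a b, ContDiffAt ℝ 1 f (x, t) ∧ ‖f' x t‖ < C + 1) :
      IntervalIntegrable (fun t => f (x, t)) MeasureTheory.volume a b :=
    ContinuousOn.intervalIntegrable fun t ht =>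
      ((hx t ht).1.continuousAt.comp (by fun_prop : ContinuousAt (Prod.mk x) t)).continuousWithinAt
  refine intervalIntegral.hasFDerivAt_integral_of_dominated_of_fderiv_le (F' := f')
    (F := fun x t => f (x, t)) (bound := fun _ => C + 1) hnear ?_ (hcont hnear.self_of_nhds)
    ?_ ?_ intervalIntegrable_const ?_
  · exact hnear.mono fun x hx => (intervalIntegrable_iff.1 (hcont hx)).aestronglyMeasurable
  · exact (intervalIntegrable_iff.1 hslice.intervalIntegrable).aestronglyMeasurable
  · exact .of_forall fun t ht x hx => (hx t (uIoc_subset_uIcc ht)).2.le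
  · exact .of_forall fun t ht x hx =>
      ((hx t (uIoc_subset_uIcc ht)).1.differentiableAt (by simp)).hasFDerivAt.comp x
        (hasFDerivAt_prodMk_left x t)

theorem contDiffAt_intervalIntegral_nat {a b : ℝ} {p : P} (n : ℕ) {F : Type u}
    [NormedAddCommGroup F] [NormedSpace ℝ F] [CompleteSpace F] {f : P × ℝ → F}
    (hf : ∀ᶠ x in 𝓝 p, ∀ t ∈ uIcc a b, ContDiffAt ℝ ∞ f (x, t)) :
    ContDiffAt ℝ n (fun p => ∫ t in a..b, f (p, t)) p := by
  induction n generalizing F with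
  | zero =>
    refine contDiffAt_zero.2 ⟨_, hf, fun x hx => ContinuousAt.continuousWithinAt ?_⟩
    exact (hasFDerivAt_intervalIntegral fun t ht => (hx t ht).of_le (by simp)).continuousAt
  | succ n ih =>
    rw [Nat.cast_succ, contDiffAt_succ_iff_hasFDerivAt]
    refine ⟨_, ⟨_, hf, fun x hx =>
      hasFDerivAt_intervalIntegral fun t ht => (hx t ht).of_le (by simp)⟩, ?_⟩
    exact ih (f := fun q => fderiv ℝ f q ∘L .inl ℝ P ℝ) <| hf.mono fun x hx t ht =>
      ((hx t ht).fderiv_right (m := ∞) (by simp)).clm_comp contDiffAt_const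

theorem exists_sub_eq_clm_apply_sub {F : Type u} [NormedAddCommGroup F] [NormedSpace ℝ F]
    [CompleteSpace F] {R : P → F} {p₀ : P} (hR : ∀ᶠ p in 𝓝 p₀, ContDiffAt ℝ ∞ R p) :
    ∃ Φ : P × P → P →L[ℝ] F, ContDiffAt ℝ ∞ Φ (p₀, p₀) ∧ Φ (p₀, p₀) = fderiv ℝ R p₀ ∧
      ∀ᶠ q in 𝓝 (p₀, p₀), R q.1 - R q.2 = Φ q (q.1 - q.2) := by
  let m (q : P × P) (t : ℝ) : P := q.2 + t • (q.1 - q.2)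
  have hm_cont (t : ℝ) : ContinuousAt (fun x : (P × P) × ℝ => m x.1 x.2) ((p₀, p₀), t) := by
    fun_prop
  have hm : ∀ᶠ q in 𝓝 (p₀, p₀), ∀ t ∈ uIcc (0 : ℝ) 1, ContDiffAt ℝ ∞ R (m q t) :=
    isCompact_uIcc.eventually_forall_of_forall_eventually fun t _ =>
      (hm_cont t).eventually (by simpa [m] using hR)
  refine ⟨fun q => ∫ t in (0 : ℝ)..1, fderiv ℝ R (m q t), ?_, by simp [m], ?_⟩
  · refine contDiffAt_infty.2 fun n => contDiffAt_intervalIntegral_nat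
      (f := fun x => fderiv ℝ R (m x.1 x.2)) n (hm.mono fun q hq t ht => ?_)
    exact ((hq t ht).fderiv_right (m := ∞) (by simp)).comp (q, t)
      (f := fun x : (P × P) × ℝ => m x.1 x.2) (by fun_prop)
  · filter_upwards [hm] with q hq
    have hderiv : ∀ t ∈ uIcc (0 : ℝ) 1,
        HasDerivAt (fun t => R (m q t)) (fderiv ℝ R (m q t) (q.1 - q.2)) t := fun t ht =>
      ((hq t ht).differentiableAt (by simp)).hasFDerivAt.comp_hasDerivAt t <| by
        simpa [m] using ((hasDerivAt_id t).smul_const (q.1 - q.2)).const_add q.2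
    have hcont : ContinuousOn (fun t => fderiv ℝ R (m q t)) (uIcc 0 1) := fun t ht =>
      (((hq t ht).fderiv_right (m := 0) (by simp)).continuousAt.comp
        (by fun_prop : ContinuousAt (m q) t)).continuousWithinAt
    rw [ContinuousLinearMap.intervalIntegral_apply hcont.intervalIntegrable,
      intervalIntegral.integral_eq_sub_of_hasDerivAt hderiv
        (hcont.clm_apply continuousOn_const).intervalIntegrable]
    simp [m]

end ParametricIntegral

section FoldAngle

/-- The distance from the angle `s` to `2πℤ`. Functions of `foldAngle s` are even and
`2π`-periodic, and any function on `[0, π]` extends to one. -/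
noncomputable def foldAngle (s : ℝ) : ℝ := arccos (cos s)

theorem foldAngle_nonneg (s : ℝ) : 0 ≤ foldAngle s := arccos_nonneg _

theorem foldAngle_le_pi (s : ℝ) : foldAngle s ≤ π := arccos_le_pi _

theorem foldAngle_of_mem_Icc {s : ℝ} (hs : s ∈ Icc 0 π) : foldAngle s = s :=
  arccos_cos hs.1 hs.2

theorem cos_foldAngle (s : ℝ) : cos (foldAngle s) = cos s :=
  cos_arccos (neg_one_le_cos s) (cos_le_one s)

theorem foldAngle_neg (s : ℝ) : foldAngle (-s) = foldAngle s := by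
  simp only [foldAngle, cos_neg]

theorem periodic_foldAngle : Function.Periodic foldAngle (2 * π) := fun s => by
  simp only [foldAngle, cos_add_two_pi]

theorem continuous_foldAngle : Continuous foldAngle :=
  continuous_arccos.comp continuous_cos

theorem apply_foldAngle_of_even_of_periodic {α : Type*} {f : ℝ → α} (heven : Function.Even f)
    (hper : Function.Periodic f (2 * π)) (s : ℝ) : f (foldAngle s) = f s := by
  obtain ⟨k, hk | hk⟩ := cos_eq_cos_iff.1 (cos_foldAngle s)
  · rw [← hper.int_mul k (foldAngle s)]
    exact congrArg f (by linarith)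
  · rw [← heven, ← hper.int_mul k (-foldAngle s)]
    exact congrArg f (by linarith)

theorem norm_integral_foldAngle_le (g : ℝ →ᵇ ℝ) (s : ℝ) :
    ‖∫ σ in (0 : ℝ)..foldAngle s, g σ‖ ≤ ‖g‖ * π := by
  refine (intervalIntegral.norm_integral_le_of_norm_le_const
    (fun x _ => g.norm_coe_le_norm x)).trans ?_
  rw [sub_zero, abs_of_nonneg (foldAngle_nonneg s)]
  gcongr
  exact foldAngle_le_pi s

/-- The bounded operator integrating from `0` to the folded angle. -/
noncomputable def foldIntegral : (ℝ →ᵇ ℝ) →L[ℝ] (ℝ →ᵇ ℝ) :=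
  LinearMap.mkContinuous
    { toFun := fun g => .ofNormedAddCommGroup (fun s => ∫ σ in (0 : ℝ)..foldAngle s, g σ)
        ((intervalIntegral.continuous_primitive (fun a b => g.continuous.intervalIntegrable a b)
          0).comp continuous_foldAngle)
        (‖g‖ * π) (norm_integral_foldAngle_le g)
      map_add' := fun f g => by
        ext s
        exact intervalIntegral.integral_add (f.continuous.intervalIntegrable _ _)
          (g.continuous.intervalIntegrable _ _)
      map_smul' := fun r f => by
        ext s
        exact intervalIntegral.integral_const_mul r f }
    π fun g => by
      rw [mul_comm]
      exact BoundedContinuousFunction.norm_ofNormedAddCommGroup_le _ (by positivity)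
        (norm_integral_foldAngle_le g)

theorem foldIntegral_apply (g : ℝ →ᵇ ℝ) (s : ℝ) :
    foldIntegral g s = ∫ σ in (0 : ℝ)..foldAngle s, g σ := rfl

theorem even_foldIntegral (g : ℝ →ᵇ ℝ) : Function.Even (foldIntegral g) := fun s => by
  simp only [foldIntegral_apply, foldAngle_neg]

theorem periodic_foldIntegral (g : ℝ →ᵇ ℝ) : Function.Periodic (foldIntegral g) (2 * π) :=
  fun s => by simp only [foldIntegral_apply, periodic_foldAngle s]

theorem foldIntegral_congr {g : ℝ →ᵇ ℝ} {f : ℝ → ℝ} (h : EqOn g f (Icc 0 π)) (s : ℝ) :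
    foldIntegral g s = ∫ σ in (0 : ℝ)..foldAngle s, f σ := by
  refine intervalIntegral.integral_congr fun σ hσ => ?_
  rw [uIcc_of_le (foldAngle_nonneg s)] at hσ
  exact h ⟨hσ.1, hσ.2.trans (foldAngle_le_pi s)⟩

end FoldAngle

theorem exp_boundedContinuousFunction_apply {α : Type*} [TopologicalSpace α] (f : α →ᵇ ℝ)
    (x : α) : NormedSpace.exp f x = exp (f x) := by
  let eval : (α →ᵇ ℝ) →+* ℝ := (Pi.evalRingHom (fun _ => ℝ) x).comp
    (ContinuousMap.coeFnRingHom.comp (BoundedContinuousFunction.toContinuousMapₐ ℝ).toRingHom)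
  rw [exp_eq_exp_ℝ]
  exact NormedSpace.map_exp eval (BoundedContinuousFunction.evalCLM ℝ x).continuous f

section HalfTurnEquation

/-- The function `s ↦ |sin s|`. -/
noncomputable def absSin : ℝ →ᵇ ℝ :=
  .ofNormedAddCommGroup (fun s => sin (foldAngle s)) (continuous_sin.comp continuous_foldAngle) 1
    fun _ => abs_sin_le_one _

/-- The cosine as a bounded continuous function. -/
noncomputable def boundedCos : ℝ →ᵇ ℝ :=
  .ofNormedAddCommGroup cos continuous_cos 1 fun _ => abs_cos_le_one _

/-- The contribution of the monomial damping `x ^ k` to the equation of orbits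
`u' = q * (cos ^ 2 + sin * cos * u')` over the half turn `[0, π]`, for the orbit with radius
`exp u` and derivative `u' = g`. The functions are folded so as to live on the whole line. -/
noncomputable def halfTurnTerm (k : ℕ) (g : ℝ →ᵇ ℝ) : ℝ →ᵇ ℝ :=
  (absSin * NormedSpace.exp (foldIntegral g)) ^ k * (boundedCos ^ 2 + absSin * boundedCos * g)

/-- The equation `halfTurnDefect (p, g) = 0` characterizes the derivative `g` of the logarithmic
radius, over a half turn starting at radius `1`, for the damping with coefficients `p`. -/
noncomputable def halfTurnDefect {m : ℕ} (x : (Fin m → ℝ) × (ℝ →ᵇ ℝ)) : ℝ →ᵇ ℝ :=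
  x.2 - ∑ k, x.1 k • halfTurnTerm k x.2

theorem halfTurnTerm_apply (k : ℕ) (g : ℝ →ᵇ ℝ) (s : ℝ) :
    halfTurnTerm k g s = (sin (foldAngle s) * exp (foldIntegral g s)) ^ k *
      (cos s ^ 2 + sin (foldAngle s) * cos s * g s) := by
  rw [← exp_boundedContinuousFunction_apply]
  rfl

theorem contDiff_halfTurnTerm (k : ℕ) : ContDiff ℝ ω (halfTurnTerm k) := by
  have hexp : ContDiff ℝ ω (fun g : ℝ →ᵇ ℝ => NormedSpace.exp (foldIntegral g)) :=
    (contDiff_iff_contDiffAt.2 fun f => (NormedSpace.exp_analytic (𝕂 := ℝ) f).contDiffAt).comp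
      foldIntegral.contDiff
  exact ((contDiff_const.mul hexp).pow k).mul (contDiff_const.add (contDiff_const.mul contDiff_id))

theorem halfTurnTerm_zero (k : ℕ) : halfTurnTerm k 0 = absSin ^ k * boundedCos ^ 2 := by
  simp [halfTurnTerm]

theorem contDiff_halfTurnDefect {m : ℕ} :
    ContDiff ℝ ω (halfTurnDefect : (Fin m → ℝ) × (ℝ →ᵇ ℝ) → (ℝ →ᵇ ℝ)) :=
  contDiff_snd.sub <| ContDiff.sum fun k _ =>
    ((contDiff_apply ℝ ℝ k).comp contDiff_fst).smul ((contDiff_halfTurnTerm k).comp contDiff_snd)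

theorem fderiv_halfTurnDefect_comp_inr {m : ℕ} :
    fderiv ℝ halfTurnDefect (0 : (Fin m → ℝ) × (ℝ →ᵇ ℝ)) ∘L .inr ℝ (Fin m → ℝ) (ℝ →ᵇ ℝ) =
      .id ℝ _ := by
  have hcomp := (contDiff_halfTurnDefect.differentiable (by simp) 0).hasFDerivAt.comp
    (0 : ℝ →ᵇ ℝ) (hasFDerivAt_prodMk_right (0 : Fin m → ℝ) 0)
  refine hcomp.unique ((hasFDerivAt_id (𝕜 := ℝ) (0 : ℝ →ᵇ ℝ)).congr_of_eventuallyEq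
    (.of_forall fun g => ?_))
  simp [halfTurnDefect]

theorem exists_halfTurnDefect_eq_zero_iff (m : ℕ) :
    ∃ γ : (Fin m → ℝ) → (ℝ →ᵇ ℝ), ContDiffAt ℝ ω γ 0 ∧ γ 0 = 0 ∧
      ∀ᶠ x in 𝓝 (0 : (Fin m → ℝ) × (ℝ →ᵇ ℝ)), halfTurnDefect x = 0 ↔ γ x.1 = x.2 := by
  have hF := (contDiff_halfTurnDefect (m := m)).contDiffAt (x := 0)
  have hinv : (fderiv ℝ halfTurnDefect (0 : (Fin m → ℝ) × (ℝ →ᵇ ℝ)) ∘L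
      .inr ℝ (Fin m → ℝ) (ℝ →ᵇ ℝ)).IsInvertible := by
    rw [fderiv_halfTurnDefect_comp_inr]
    exact ⟨ContinuousLinearEquiv.refl ℝ _, rfl⟩
  have hzero : halfTurnDefect (0 : (Fin m → ℝ) × (ℝ →ᵇ ℝ)) = 0 := by simp [halfTurnDefect]
  refine ⟨hF.implicitFunction (by simp) hinv, hF.contDiffAt_implicitFunction (by simp) hinv,
    hF.implicitFunction_apply_self (by simp) hinv, ?_⟩
  have := hF.eventually_apply_eq_iff_implicitFunction (by simp) hinv
  rwa [hzero] at this

theorem fderiv_single_of_halfTurnDefect_eq_zero {m : ℕ} {γ : (Fin m → ℝ) → (ℝ →ᵇ ℝ)}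
    (hγ : DifferentiableAt ℝ γ 0) (hγ₀ : γ 0 = 0)
    (h : ∀ᶠ p in 𝓝 0, halfTurnDefect (p, γ p) = 0) (k : Fin m) :
    fderiv ℝ γ 0 (Pi.single k 1) = absSin ^ (k : ℕ) * boundedCos ^ 2 := by
  have hfix : γ =ᶠ[𝓝 0] fun p => ∑ j, p j • halfTurnTerm j (γ p) :=
    h.mono fun p hp => sub_eq_zero.1 hp
  have hterm (j : Fin m) : HasFDerivAt (fun p : Fin m → ℝ => p j • halfTurnTerm j (γ p))
      ((ContinuousLinearMap.proj (R := ℝ) (φ := fun _ => ℝ) j).smulRight (halfTurnTerm j 0)) 0 := by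
    have hdiff : DifferentiableAt ℝ (fun p => halfTurnTerm j (γ p)) 0 :=
      ((contDiff_halfTurnTerm j).differentiable (by simp) _).comp 0 hγ
    refine ((hasFDerivAt_apply (𝕜 := ℝ) j (0 : Fin m → ℝ)).smul hdiff.hasFDerivAt).congr_fderiv ?_
    simp [hγ₀]
  rw [((HasFDerivAt.fun_sum fun j _ => hterm j).congr_of_eventuallyEq hfix).fderiv]
  simp [Pi.single_apply, halfTurnTerm_zero]

theorem integral_sin_pow_mul_cos_sq_pos (k : ℕ) :
    0 < ∫ s in (0 : ℝ)..π, sin s ^ k * cos s ^ 2 := by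
  refine intervalIntegral.integral_pos pi_pos (by fun_prop) (fun x hx => ?_)
    ⟨π / 4, ⟨by positivity, by linarith [pi_pos]⟩, ?_⟩
  · have := sin_nonneg_of_nonneg_of_le_pi hx.1.le hx.2
    positivity
  · rw [sin_pi_div_four, cos_pi_div_four]
    positivity

end HalfTurnEquation

section IntegralCurves

variable {E : Type*} [NormedAddCommGroup E] [NormedSpace ℝ E] {X : E → E}

theorem eq_of_isIntegralCurve (hX : ContDiff ℝ 1 X) {γ₁ γ₂ : ℝ → E}
    (h₁ : IsIntegralCurve γ₁ (fun _ => X)) (h₂ : IsIntegralCurve γ₂ (fun _ => X)) {t₀ : ℝ}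
    (h : γ₁ t₀ = γ₂ t₀) : γ₁ = γ₂ :=
  isMIntegralCurve_Ioo_eq_of_contMDiff_boundaryless (I := 𝓘(ℝ, E)) (v := X) (t₀ := t₀)
    (contMDiff_vectorSpace_iff_contDiff.2 hX) (fun t => (h₁ t).hasFDerivAt.hasMFDerivAt)
    (fun t => (h₂ t).hasFDerivAt.hasMFDerivAt) h

theorem apply_add_sub_of_isIntegralCurve_of_periodic (hX : ContDiff ℝ 1 X) {w : E}
    (hw : Function.Periodic X w) {Λ : ℝ → E} (hΛ : IsIntegralCurve Λ (fun _ => X)) {t₀ t₁ : ℝ}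
    (h : Λ t₁ = Λ t₀ + w) (t : ℝ) : Λ (t + (t₁ - t₀)) = Λ t + w := by
  have hshift : IsIntegralCurve (fun t => Λ t + w) (fun _ => X) := fun t => by
    simpa only [hw (Λ t)] using (hΛ t).add_const w
  exact congrFun (eq_of_isIntegralCurve hX (hΛ.comp_add (t₁ - t₀)) hshift (t₀ := t₀)
    (by simpa using h)) t

end IntegralCurves

theorem IsPeriodicOrbit.eq_of_mem {X : ℝ × ℝ → ℝ × ℝ} (hX : ContDiff ℝ 1 X)
    {Γ₁ Γ₂ : Set (ℝ × ℝ)} (h₁ : IsPeriodicOrbit X Γ₁) (h₂ : IsPeriodicOrbit X Γ₂) {z : ℝ × ℝ}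
    (hz₁ : z ∈ Γ₁) (hz₂ : z ∈ Γ₂) : Γ₁ = Γ₂ := by
  obtain ⟨γ₁, hγ₁, -, -, rfl⟩ := h₁
  obtain ⟨γ₂, hγ₂, -, -, rfl⟩ := h₂
  obtain ⟨a, rfl⟩ := hz₁
  obtain ⟨b, hb⟩ := hz₂
  have heq : γ₁ ∘ (· + a) = γ₂ ∘ (· + b) :=
    eq_of_isIntegralCurve hX (hγ₁.comp_add a) (hγ₂.comp_add b) (t₀ := 0) (by simp [hb])
  rw [← (add_right_surjective a).range_comp γ₁, ← (add_right_surjective b).range_comp γ₂, heq]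

section TimeChange

theorem exists_orderIso_of_le_hasDerivAt {f f' : ℝ → ℝ} {m : ℝ} (hm : 0 < m)
    (hf : ∀ t, HasDerivAt f (f' t) t) (hf' : ∀ t, m ≤ f' t) :
    ∃ e : ℝ ≃o ℝ, (∀ t, e t = f t) ∧ ∀ s, HasDerivAt e.symm (f' (e.symm s))⁻¹ s := by
  have hmono : StrictMono f := strictMono_of_hasDerivAt_pos hf fun t => hm.trans_le (hf' t)
  have hcont : Continuous f := continuous_iff_continuousAt.2 fun t => (hf t).continuousAt
  have hgrow : ∀ ⦃x y : ℝ⦄, x ≤ y → m * (y - x) ≤ f y - f x :=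
    mul_sub_le_image_sub_of_le_deriv (fun t => (hf t).differentiableAt)
      fun t => (hf t).deriv.symm ▸ hf' t
  have hsurj : Function.Surjective f := by
    intro s
    have hcancel : m * (|s - f 0| / m) = |s - f 0| := by field_simp
    have hnonneg : 0 ≤ |s - f 0| / m := by positivity
    refine mem_range_of_exists_le_of_exists_ge hcont ⟨-(|s - f 0| / m), ?_⟩ ⟨|s - f 0| / m, ?_⟩
    · linarith [hgrow (neg_nonpos.2 hnonneg), neg_abs_le (s - f 0)]
    · linarith [hgrow hnonneg, le_abs_self (s - f 0)]
  let e := hmono.orderIsoOfSurjective f hsurj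
  exact ⟨e, fun _ => rfl, fun s => .of_local_left_inverse e.symm.continuous.continuousAt (hf _)
    (hm.trans_le (hf' _)).ne' (.of_forall e.apply_symm_apply)⟩

variable {X : ℝ × ℝ → ℝ × ℝ} {m : ℝ}

theorem exists_graph_of_isIntegralCurve (hm : 0 < m) {Λ : ℝ → ℝ × ℝ}
    (hΛ : IsIntegralCurve Λ (fun _ => X)) (hspeed : ∀ t, m ≤ (X (Λ t)).2) :
    ∃ (u : ℝ → ℝ) (e : ℝ ≃o ℝ), (∀ t, Λ t = (u (e t), e t)) ∧
      ∀ s, HasDerivAt u ((X (u s, s)).1 / (X (u s, s)).2) s := by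
  obtain ⟨e, he, he'⟩ := exists_orderIso_of_le_hasDerivAt hm (fun t => (hΛ t).snd) hspeed
  have hpoint (t : ℝ) : Λ t = ((Λ (e.symm (e t))).1, e t) := by
    rw [e.symm_apply_apply, he]
  have hcurve (s : ℝ) : Λ (e.symm s) = ((Λ (e.symm s)).1, s) := by
    simpa using hpoint (e.symm s)
  refine ⟨fun s => (Λ (e.symm s)).1, e, hpoint, fun s => ?_⟩
  rw [← hcurve, div_eq_mul_inv]
  exact HasDerivAt.comp s (hΛ (e.symm s)).fst (he' s)

theorem exists_isIntegralCurve_of_graph (hm : 0 < m) {M : ℝ} (hX : Continuous X) {u : ℝ → ℝ}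
    (hu : ∀ s, HasDerivAt u ((X (u s, s)).1 / (X (u s, s)).2) s)
    (hspeed : ∀ s, (X (u s, s)).2 ∈ Icc m M) :
    ∃ e : ℝ ≃o ℝ, IsIntegralCurve (fun t => (u (e t), e t)) (fun _ => X) := by
  have hcont : Continuous u := continuous_iff_continuousAt.2 fun s => (hu s).continuousAt
  have hpos (s : ℝ) : 0 < (X (u s, s)).2 := hm.trans_le (hspeed s).1
  have htime : Continuous fun s => ((X (u s, s)).2)⁻¹ :=
    (hX.comp (hcont.prodMk continuous_id)).snd.inv₀ fun s => (hpos s).ne'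
  obtain ⟨e, -, he'⟩ := exists_orderIso_of_le_hasDerivAt
    (inv_pos.2 (hm.trans_le ((hspeed 0).1.trans (hspeed 0).2)))
    (fun s => (htime.integral_hasStrictDerivAt 0 s).hasDerivAt)
    (fun s => inv_anti₀ (hpos s) (hspeed s).2)
  refine ⟨e.symm, fun t => ?_⟩
  have hangle := he' t
  rw [inv_inv] at hangle
  exact (((hu _).comp t hangle).prodMk hangle).congr_deriv
    (Prod.ext (div_mul_cancel₀ _ (hpos _).ne') rfl)

end TimeChange

theorem exists_apply_add_eq_of_apply_add_nsmul_eq {u : ℝ → ℝ} (hu : Continuous u) {p a : ℝ} {n : ℕ}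
    (hn : 0 < n) (h : u (a + n * p) = u a) : ∃ s, u (s + p) = u s := by
  have hsum : ∑ j ∈ Finset.range n, (u (a + j * p + p) - u (a + j * p)) = 0 := by
    simpa [h, add_mul, add_assoc] using Finset.sum_range_sub (fun j : ℕ => u (a + j * p)) n
  have hne : (Finset.range n).Nonempty := Finset.nonempty_range_iff.2 hn.ne'
  obtain ⟨i, -, hi⟩ := Finset.exists_le_of_sum_le hne (hsum.trans Finset.sum_const_zero.symm).le
  obtain ⟨j, -, hj⟩ := Finset.exists_le_of_sum_le hne (Finset.sum_const_zero.trans hsum.symm).le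
  obtain ⟨s, hs⟩ := mem_range_of_exists_le_of_exists_ge
    (by fun_prop : Continuous fun s => u (s + p) - u s) ⟨_, hi⟩ ⟨_, hj⟩
  exact ⟨s, sub_eq_zero.1 hs⟩

theorem exists_hasDerivAt_exp_eq {ζ ζ' : ℝ → ℂ} (hζ : ∀ t, HasDerivAt ζ (ζ' t) t)
    (hζ' : Continuous ζ') (h0 : ∀ t, ζ t ≠ 0) :
    ∃ w : ℝ → ℂ, (∀ t, HasDerivAt w (ζ' t / ζ t) t) ∧ ∀ t, Complex.exp (w t) = ζ t := by
  have hcont : Continuous ζ := continuous_iff_continuousAt.2 fun t => (hζ t).continuousAt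
  let w : ℝ → ℂ := fun t => Complex.log (ζ 0) + ∫ σ in (0 : ℝ)..t, ζ' σ / ζ σ
  have hw (t : ℝ) : HasDerivAt w (ζ' t / ζ t) t :=
    (((hζ'.div hcont h0).integral_hasStrictDerivAt 0 t).hasDerivAt).const_add _
  have hderiv (t : ℝ) : HasDerivAt (fun t => ζ t * Complex.exp (-w t)) 0 t := by
    refine ((hζ t).mul (hw t).neg.cexp).congr_deriv ?_
    have := h0 t
    field_simp
    ring
  have hconst (t : ℝ) : ζ t * Complex.exp (-w t) = 1 := by
    rw [is_const_of_deriv_eq_zero (fun t => (hderiv t).differentiableAt)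
      (fun t => (hderiv t).deriv) t 0]
    simp only [w, intervalIntegral.integral_same, add_zero, Complex.exp_neg,
      Complex.exp_log (h0 0), mul_inv_cancel₀ (h0 0)]
  refine ⟨w, hw, fun t => ?_⟩
  exact (eq_of_mul_inv_eq_one (by rw [← Complex.exp_neg, hconst])).symm

/-- The vector field of `x' = y`, `y' = -x + q(x) y`, with an arbitrary damping `q`. -/
def dampedField (q : ℝ → ℝ) (z : ℝ × ℝ) : ℝ × ℝ := (z.2, -z.1 + q z.1 * z.2)

/-- The point with logarithmic radius `v.1` and angle `v.2`. The angle is measured from the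
positive `y`-axis towards the positive `x`-axis, so that it increases along the linear center. -/
noncomputable def polarPoint (v : ℝ × ℝ) : ℝ × ℝ := (exp v.1 * sin v.2, exp v.1 * cos v.2)

/-- The field `dampedField q` in the coordinates of `polarPoint`. -/
noncomputable def polarField (q : ℝ → ℝ) (v : ℝ × ℝ) : ℝ × ℝ :=
  (q (polarPoint v).1 * cos v.2 ^ 2, 1 - q (polarPoint v).1 * (sin v.2 * cos v.2))

/-- The slope of the orbits of `polarField q`, as graphs of functions of the angle. -/
noncomputable def polarSlope (q : ℝ → ℝ) (v : ℝ × ℝ) : ℝ := (polarField q v).1 / (polarField q v).2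

section PolarCoordinates

theorem contDiff_polarPoint {n : WithTop ℕ∞} : ContDiff ℝ n polarPoint := by
  unfold polarPoint
  fun_prop

theorem equivRealProd_symm_polarPoint_swap (v : ℝ × ℝ) :
    Complex.equivRealProd.symm (polarPoint v).swap =
      Complex.exp (Complex.equivRealProd.symm v) := by
  apply Complex.ext <;>
    simp [polarPoint, Complex.exp_re, Complex.exp_im, Complex.cos_ofReal_re, Complex.sin_ofReal_re]

theorem polarPoint_eq_polarPoint_iff {v w : ℝ × ℝ} :
    polarPoint v = polarPoint w ↔ ∃ n : ℤ, v = w + (0, n * (2 * π)) := by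
  rw [← Prod.swap_inj, ← Complex.equivRealProd.symm.apply_eq_iff_eq,
    equivRealProd_symm_polarPoint_swap, equivRealProd_symm_polarPoint_swap,
    Complex.exp_eq_exp_iff_exists_int]
  simp [Complex.ext_iff, Prod.ext_iff]

theorem periodic_polarPoint : Function.Periodic polarPoint (0, 2 * π) := fun v =>
  polarPoint_eq_polarPoint_iff.2 ⟨1, by simp⟩

theorem sq_add_sq_polarPoint (v : ℝ × ℝ) : (polarPoint v).1 ^ 2 + (polarPoint v).2 ^ 2 =
    exp v.1 ^ 2 := by
  simp only [polarPoint]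
  linear_combination exp v.1 ^ 2 * sin_sq_add_cos_sq v.2

variable {q : ℝ → ℝ}

theorem contDiff_dampedField {n : WithTop ℕ∞} (hq : ContDiff ℝ n q) :
    ContDiff ℝ n (dampedField q) := by
  unfold dampedField
  fun_prop

theorem contDiff_polarField {n : WithTop ℕ∞} (hq : ContDiff ℝ n q) :
    ContDiff ℝ n (polarField q) := by
  have hdamp : ContDiff ℝ n fun v => q (polarPoint v).1 :=
    hq.comp (contDiff_fst.comp contDiff_polarPoint)
  unfold polarField
  fun_prop

theorem periodic_polarField : Function.Periodic (polarField q) (0, 2 * π) := fun v => by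
  simp only [polarField, periodic_polarPoint v]
  simp

theorem polarField_snd_mem_Icc {v : ℝ × ℝ} (hq : |q (polarPoint v).1| ≤ 1 / 2) :
    (polarField q v).2 ∈ Icc (1 / 2) 2 := by
  have hprod : |q (polarPoint v).1 * (sin v.2 * cos v.2)| ≤ 1 / 2 * 1 := by
    rw [abs_mul, abs_mul (sin v.2)]
    exact mul_le_mul hq (mul_le_one₀ (abs_sin_le_one _) (abs_nonneg _) (abs_cos_le_one _))
      (by positivity) (by norm_num)
  have hbounds := abs_le.1 hprod
  constructor <;> simp only [polarField] <;> linarith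

theorem continuous_polarSlope_comp (hq : Continuous q) {X : Type*} [TopologicalSpace X]
    {v : X → ℝ × ℝ} (hv : Continuous v) (hsmall : ∀ x, |q (polarPoint (v x)).1| ≤ 1 / 2) :
    Continuous fun x => polarSlope q (v x) := by
  have hfield : Continuous (polarField q) := (contDiff_polarField (contDiff_zero.2 hq)).continuous
  refine Continuous.div (by fun_prop) (by fun_prop) fun x => ne_of_gt ?_
  exact one_half_pos.trans_le (polarField_snd_mem_Icc (hsmall x)).1

theorem abs_polarSlope_le {v : ℝ × ℝ} {η : ℝ} (hη : η ≤ 1 / 2) (hq : |q (polarPoint v).1| ≤ η) :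
    |polarSlope q v| ≤ 2 * η := by
  have hspeed := (polarField_snd_mem_Icc (hq.trans hη)).1
  have hfst : |(polarField q v).1| ≤ η * 1 := by
    rw [polarField, abs_mul, abs_of_nonneg (sq_nonneg (cos v.2))]
    exact mul_le_mul hq (cos_sq_le_one _) (sq_nonneg _) ((abs_nonneg _).trans hq)
  rw [polarSlope, abs_div, abs_of_pos (one_half_pos.trans_le hspeed),
    div_le_iff₀ (one_half_pos.trans_le hspeed)]
  nlinarith [(abs_nonneg _).trans hq]

theorem isIntegralCurve_polarPoint_comp {Λ : ℝ → ℝ × ℝ}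
    (hΛ : IsIntegralCurve Λ (fun _ => polarField q)) :
    IsIntegralCurve (fun t => polarPoint (Λ t)) (fun _ => dampedField q) := by
  intro t
  have hrad : HasDerivAt (fun t => (Λ t).1) (polarField q (Λ t)).1 t := (hΛ t).fst
  have hang : HasDerivAt (fun t => (Λ t).2) (polarField q (Λ t)).2 t := (hΛ t).snd
  refine ((hrad.exp.mul hang.sin).prodMk (hrad.exp.mul hang.cos)).congr_deriv ?_
  simp only [dampedField, polarField, polarPoint]
  refine Prod.ext (by ring) ?_
  linear_combination exp (Λ t).1 * q (exp (Λ t).1 * sin (Λ t).2) * cos (Λ t).2 *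
    sin_sq_add_cos_sq (Λ t).2

theorem dampedField_swap_div_polarPoint_swap (v : ℝ × ℝ) :
    Complex.equivRealProd.symm (dampedField q (polarPoint v)).swap /
      Complex.equivRealProd.symm (polarPoint v).swap =
      Complex.equivRealProd.symm (polarField q v) := by
  have hne : Complex.equivRealProd.symm (polarPoint v).swap ≠ 0 :=
    equivRealProd_symm_polarPoint_swap v ▸ Complex.exp_ne_zero _
  rw [div_eq_iff hne]
  apply Complex.ext <;>
    simp only [dampedField, polarField, Complex.equivRealProd_symm_apply, Prod.fst_swap,
      Prod.snd_swap, Complex.mul_re, Complex.mul_im, Complex.add_re, Complex.add_im,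
      Complex.ofReal_re, Complex.ofReal_im, Complex.I_re, Complex.I_im]
  · simp only [polarPoint]
    linear_combination (-exp v.1 * q (exp v.1 * sin v.2) * cos v.2) * sin_sq_add_cos_sq v.2
  · simp only [polarPoint]
    ring

theorem exists_isIntegralCurve_polarField (hq : Continuous q) {γ : ℝ → ℝ × ℝ}
    (hγ : IsIntegralCurve γ (fun _ => dampedField q)) (h0 : ∀ t, γ t ≠ 0) :
    ∃ Λ, IsIntegralCurve Λ (fun _ => polarField q) ∧ ∀ t, polarPoint (Λ t) = γ t := by
  let toComplex : (ℝ × ℝ) ≃L[ℝ] ℂ :=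
    (ContinuousLinearEquiv.prodComm ℝ ℝ ℝ).trans Complex.equivRealProdCLM.symm
  have hcont : Continuous (dampedField q) := by unfold dampedField; fun_prop
  obtain ⟨w, hw, hexp⟩ := exists_hasDerivAt_exp_eq (ζ := fun t => toComplex (γ t))
    (fun t => toComplex.hasFDerivAt.comp_hasDerivAt t (hγ t))
    (toComplex.continuous.comp (hcont.comp hγ.continuous))
    (fun t => (map_ne_zero_iff _ toComplex.injective).2 (h0 t))
  have hpoint (t : ℝ) : polarPoint (Complex.equivRealProdCLM (w t)) = γ t :=
    toComplex.injective ((equivRealProd_symm_polarPoint_swap _).trans (hexp t))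
  refine ⟨fun t => Complex.equivRealProdCLM (w t), fun t => ?_, hpoint⟩
  refine (Complex.equivRealProdCLM.hasFDerivAt.comp_hasDerivAt t (hw t)).congr_deriv ?_
  rw [← hpoint]
  exact (Complex.equivRealProdCLM.symm_apply_eq.1
    (dampedField_swap_div_polarPoint_swap _).symm).symm

end PolarCoordinates

/-- `u` is the logarithmic radius, as a function of the angle, of a closed orbit of `dampedField q`
winding once around the origin, the damping being at most `1 / 2` along the orbit so that the
angular speed does not degenerate. -/
structure IsPolarOrbit (q u : ℝ → ℝ) : Prop where
  hasDerivAt (s : ℝ) : HasDerivAt u (polarSlope q (u s, s)) s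
  periodic : Function.Periodic u (2 * π)
  abs_damping_le (s : ℝ) : |q (polarPoint (u s, s)).1| ≤ 1 / 2

/-- The closed curve with logarithmic radius `u`. -/
def polarOrbit (u : ℝ → ℝ) : Set (ℝ × ℝ) := range fun s => polarPoint (u s, s)

/-- The open disc about the origin with logarithmic radius `t`. -/
def logDisc (t : ℝ) : Set (ℝ × ℝ) := {z | z.1 ^ 2 + z.2 ^ 2 < exp t ^ 2}

section PolarOrbits

variable {q u : ℝ → ℝ}

theorem polarPoint_mem_polarOrbit_iff (hu : Function.Periodic u (2 * π)) {r s : ℝ} :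
    polarPoint (r, s) ∈ polarOrbit u ↔ r = u s := by
  refine ⟨fun ⟨σ, hσ⟩ => ?_, fun h => ⟨s, by rw [h]⟩⟩
  obtain ⟨n, hn⟩ := polarPoint_eq_polarPoint_iff.1 hσ
  obtain ⟨hr, rfl⟩ := Prod.ext_iff.1 hn
  simpa [hu.int_mul n s] using hr.symm

theorem polarPoint_mem_logDisc_iff {v : ℝ × ℝ} {t : ℝ} : polarPoint v ∈ logDisc t ↔ v.1 < t := by
  rw [logDisc, mem_ofPred_eq, sq_add_sq_polarPoint,
    pow_lt_pow_iff_left₀ (exp_pos _).le (exp_pos _).le two_ne_zero, exp_lt_exp]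

theorem logDisc_mem_nhds (t : ℝ) : logDisc t ∈ 𝓝 0 := by
  have hopen : IsOpen (logDisc t) := isOpen_lt (by fun_prop) continuous_const
  exact hopen.mem_nhds (by simpa [logDisc] using pow_pos (exp_pos t) 2)

theorem abs_fst_le_of_mem_logDisc {z : ℝ × ℝ} {t : ℝ} (hz : z ∈ logDisc t) : |z.1| ≤ exp t :=
  abs_le_of_sq_le_sq ((le_add_of_nonneg_right (sq_nonneg z.2)).trans (le_of_lt hz)) (exp_pos t).le

theorem ne_zero_of_isIntegralCurve_dampedField (hq : ContDiff ℝ 1 q) {γ : ℝ → ℝ × ℝ}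
    (hγ : IsIntegralCurve γ (fun _ => dampedField q)) (hne : ∃ s t, γ s ≠ γ t) (t : ℝ) :
    γ t ≠ 0 := by
  intro ht
  obtain ⟨s₁, s₂, hs⟩ := hne
  have hzero : IsIntegralCurve (fun _ : ℝ => (0 : ℝ × ℝ)) (fun _ => dampedField q) :=
    isIntegralCurve_const fun _ => by simp [dampedField]
  exact hs (by rw [eq_of_isIntegralCurve (contDiff_dampedField hq) hγ hzero ht])

theorem isPolarOrbit_of_isIntegralCurve_polarField (hq : ContDiff ℝ 1 q) {Λ : ℝ → ℝ × ℝ}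
    (hΛ : IsIntegralCurve Λ (fun _ => polarField q))
    (hsmall : ∀ t, |q (polarPoint (Λ t)).1| ≤ 1 / 2) {T : ℝ} (hT : 0 < T)
    (hper : polarPoint (Λ T) = polarPoint (Λ 0)) :
    ∃ u, IsPolarOrbit q u ∧ (range fun t => polarPoint (Λ t)) = polarOrbit u := by
  obtain ⟨u, e, he, hu⟩ := exists_graph_of_isIntegralCurve one_half_pos hΛ
    fun t => (polarField_snd_mem_Icc (hsmall t)).1
  have hgraph (s : ℝ) : Λ (e.symm s) = (u s, s) := by rw [he, e.apply_symm_apply]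
  obtain ⟨n, hn⟩ := polarPoint_eq_polarPoint_iff.1 hper
  simp only [he, Prod.ext_iff, Prod.fst_add, Prod.snd_add, add_zero] at hn
  have hn₀ : 0 < n := by
    have hlt := e.strictMono hT
    rw [hn.2, lt_add_iff_pos_right] at hlt
    exact_mod_cast pos_of_mul_pos_left hlt two_pi_pos.le
  lift n to ℕ using hn₀.le
  have hcont : Continuous u := continuous_iff_continuousAt.2 fun s => (hu s).continuousAt
  obtain ⟨s₀, hs₀⟩ := exists_apply_add_eq_of_apply_add_nsmul_eq hcont (by exact_mod_cast hn₀)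
    (p := 2 * π) (a := e 0) (n := n) (by simpa [hn.2] using hn.1)
  have hshift := apply_add_sub_of_isIntegralCurve_of_periodic (contDiff_polarField hq)
    periodic_polarField hΛ (t₀ := e.symm s₀) (t₁ := e.symm (s₀ + 2 * π))
    (by simp [hgraph, hs₀])
  refine ⟨u, ⟨hu, fun s => ?_, fun s => hgraph s ▸ hsmall _⟩, ?_⟩
  · have h := hshift (e.symm s)
    simp only [he, Prod.mk_add_mk, Prod.mk.injEq, e.apply_symm_apply, add_zero] at h
    rw [← h.2, h.1]
  · simp only [he]
    exact e.surjective.range_comp fun s => polarPoint (u s, s)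

theorem IsPeriodicOrbit.exists_isPolarOrbit (hq : ContDiff ℝ 1 q) {Γ : Set (ℝ × ℝ)}
    (hΓ : IsPeriodicOrbit (dampedField q) Γ) (hsmall : ∀ z ∈ Γ, |q z.1| ≤ 1 / 2) :
    ∃ u, IsPolarOrbit q u ∧ Γ = polarOrbit u := by
  obtain ⟨γ, hγ, ⟨T, hT, hper⟩, hne, rfl⟩ := hΓ
  obtain ⟨Λ, hΛ, hpoint⟩ := exists_isIntegralCurve_polarField hq.continuous hγ
    (ne_zero_of_isIntegralCurve_dampedField hq hγ hne)
  simp only [forall_mem_range, ← hpoint] at hsmall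
  rw [← funext hpoint]
  exact isPolarOrbit_of_isIntegralCurve_polarField hq hΛ hsmall hT
    (by rw [hpoint, hpoint, hper.eq])

theorem IsPolarOrbit.continuous (hu : IsPolarOrbit q u) : Continuous u :=
  continuous_iff_continuousAt.2 fun s => (hu.hasDerivAt s).continuousAt

theorem IsPolarOrbit.isPeriodicOrbit (hq : ContDiff ℝ 1 q) (hu : IsPolarOrbit q u) :
    IsPeriodicOrbit (dampedField q) (polarOrbit u) := by
  obtain ⟨e, he⟩ := exists_isIntegralCurve_of_graph one_half_pos (contDiff_polarField hq).continuous
    hu.hasDerivAt fun s => polarField_snd_mem_Icc (hu.abs_damping_le s)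
  have hshift := apply_add_sub_of_isIntegralCurve_of_periodic (contDiff_polarField hq)
    periodic_polarField he (t₀ := e.symm 0) (t₁ := e.symm (2 * π)) (by simp [hu.periodic.eq])
  refine ⟨fun t => polarPoint (u (e t), e t), isIntegralCurve_polarPoint_comp he,
    ⟨e.symm (2 * π) - e.symm 0, sub_pos.2 (e.symm.strictMono two_pi_pos), fun t => ?_⟩,
    ⟨e.symm 0, e.symm π, fun h => ?_⟩, (e.surjective.range_comp _).symm⟩
  · simp only [hshift t, periodic_polarPoint _]
  · have hy := congrArg Prod.snd h
    simp only [polarPoint, e.apply_symm_apply, cos_zero, cos_pi] at hy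
    linarith [exp_pos (u 0), exp_pos (u π)]

theorem IsPolarOrbit.comp_neg (hu : IsPolarOrbit q u) :
    IsPolarOrbit (fun x => -q (-x)) (fun s => u (-s)) where
  hasDerivAt s := by
    refine ((hu.hasDerivAt (-s)).comp s (hasDerivAt_neg s)).congr_deriv ?_
    simp [polarSlope, polarField, polarPoint, neg_div]
  periodic s := by simp only [neg_add, ← sub_eq_add_neg, hu.periodic.sub_eq]
  abs_damping_le s := by simpa [polarPoint] using hu.abs_damping_le (-s)

end PolarOrbits

theorem eq_of_monotone_of_periodic {f : ℝ → ℝ} (hf : Monotone f) {T : ℝ} (hT : 0 < T)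
    (hper : Function.Periodic f T) (s t : ℝ) : f s = f t := by
  wlog hst : s ≤ t generalizing s t
  · exact (this t s (le_of_not_ge hst)).symm
  obtain ⟨n, hn⟩ := exists_nat_ge ((t - s) / T)
  rw [div_le_iff₀ hT] at hn
  refine le_antisymm (hf hst) ?_
  rw [← hper.nat_mul n s]
  exact hf (by linarith)

theorem not_isPeriodicOrbit_dampedField {q : ℝ → ℝ} {Γ : Set (ℝ × ℝ)} {a : ℝ}
    (hsign : ∀ z ∈ Γ, 0 < a * q z.1) : ¬IsPeriodicOrbit (dampedField q) Γ := by
  rintro ⟨γ, hγ, ⟨T, hT, hper⟩, ⟨t₁, t₂, hne⟩, rfl⟩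
  rw [forall_mem_range] at hsign
  have hfst (t : ℝ) : HasDerivAt (fun t => (γ t).1) (γ t).2 t := (hγ t).fst
  have hsnd (t : ℝ) : HasDerivAt (fun t => (γ t).2) (-(γ t).1 + q (γ t).1 * (γ t).2) t :=
    (hγ t).snd
  let energy : ℝ → ℝ := fun t => a * ((γ t).1 ^ 2 + (γ t).2 ^ 2)
  have henergy (t : ℝ) : HasDerivAt energy (2 * (a * q (γ t).1) * (γ t).2 ^ 2) t := by
    refine ((((hfst t).pow 2).add ((hsnd t).pow 2)).const_mul a).congr_deriv ?_
    push_cast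
    ring
  have hmono : Monotone energy := monotone_of_hasDerivAt_nonneg henergy fun t =>
    mul_nonneg (mul_nonneg zero_le_two (hsign t).le) (sq_nonneg _)
  have hconst := eq_of_monotone_of_periodic hmono hT fun t => by simp only [energy, hper t]
  have hy (t : ℝ) : (γ t).2 = 0 := by
    have hzero : HasDerivAt energy 0 t := by
      rw [funext fun s => hconst s 0]
      exact hasDerivAt_const _ _
    have hmul := (henergy t).unique hzero
    exact pow_eq_zero_iff two_ne_zero |>.1
      ((mul_eq_zero.1 hmul).resolve_left (mul_pos two_pos (hsign t)).ne')
  refine hne (Prod.ext ?_ (by rw [hy, hy]))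
  exact is_const_of_deriv_eq_zero (fun t => (hfst t).differentiableAt)
    (fun t => (hfst t).deriv.trans (hy t)) t₁ t₂

section DampingPolynomials

variable {m : ℕ}

/-- The polynomial damping with coefficient vector `c`. -/
def dampingPoly (c : Fin m → ℝ) (x : ℝ) : ℝ := ∑ k, c k * x ^ (k : ℕ)

/-- The coefficients of the damping after the orbits are rescaled by `exp t`. -/
noncomputable def scaledCoeff (c : Fin m → ℝ) (t : ℝ) : Fin m → ℝ :=
  fun k => c k * exp ((k : ℕ) * t)

/-- The infinitesimal generator of `scaledCoeff`. -/
def scalingGenerator (m : ℕ) : (Fin m → ℝ) →L[ℝ] (Fin m → ℝ) :=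
  .pi fun k => ((k : ℕ) : ℝ) • .proj k

/-- The coefficients of the damping `x ↦ -q (-x)` obtained from `q` by the time reversal
`(x, y, t) ↦ (-x, y, -t)`. -/
def reflectCoeff (m : ℕ) : (Fin m → ℝ) →L[ℝ] (Fin m → ℝ) :=
  .pi fun k => ((-1 : ℝ) ^ ((k : ℕ) + 1)) • .proj k

theorem contDiff_dampingPoly (c : Fin m → ℝ) {n : WithTop ℕ∞} : ContDiff ℝ n (dampingPoly c) :=
  .sum fun _ _ => contDiff_const.mul (contDiff_id.pow _)

theorem abs_dampingPoly_le (c : Fin m → ℝ) {x X : ℝ} (hX : 1 ≤ X) (hx : |x| ≤ X) :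
    |dampingPoly c x| ≤ m * (‖c‖ * X ^ m) := by
  refine (Finset.abs_sum_le_sum_abs _ _).trans ?_
  refine (Finset.sum_le_card_nsmul _ _ (‖c‖ * X ^ m) fun k _ => ?_).trans (by simp)
  rw [abs_mul, abs_pow]
  gcongr
  · exact norm_le_pi_norm c k
  · exact (pow_le_pow_left₀ (abs_nonneg x) hx _).trans (pow_le_pow_right₀ hX k.2.le)

theorem odd_dampingPoly {c : Fin m → ℝ} (hc : ∀ k : Fin m, Even (k : ℕ) → c k = 0) :
    Function.Odd (dampingPoly c) := fun x => by
  rw [dampingPoly, dampingPoly, ← Finset.sum_neg_distrib]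
  refine Finset.sum_congr rfl fun k _ => ?_
  rcases Nat.even_or_odd (k : ℕ) with hk | hk
  · simp [hc k hk]
  · rw [hk.neg_pow, mul_neg]

theorem dampingPoly_scaledCoeff (c : Fin m → ℝ) (t x : ℝ) :
    dampingPoly (scaledCoeff c t) x = dampingPoly c (exp t * x) := by
  refine Finset.sum_congr rfl fun k _ => ?_
  rw [scaledCoeff, exp_nat_mul]
  ring

theorem monotone_norm_scaledCoeff (c : Fin m → ℝ) : Monotone fun t => ‖scaledCoeff c t‖ := by
  intro s t hst
  refine (pi_norm_le_iff_of_nonneg (norm_nonneg _)).2 fun k => ?_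
  refine le_trans ?_ (norm_le_pi_norm (scaledCoeff c t) k)
  simp only [scaledCoeff, norm_mul, norm_eq_abs, abs_exp]
  gcongr

theorem hasDerivAt_scaledCoeff (c : Fin m → ℝ) (t : ℝ) :
    HasDerivAt (scaledCoeff c) (scalingGenerator m (scaledCoeff c t)) t := by
  refine hasDerivAt_pi.2 fun k => ?_
  refine ((((hasDerivAt_id t).const_mul ((k : ℕ) : ℝ)).exp).const_mul (c k)).congr_deriv ?_
  simp only [scalingGenerator, scaledCoeff, id, mul_one, ContinuousLinearMap.coe_pi',
    smul_apply, ContinuousLinearMap.proj_apply, smul_eq_mul]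
  ring

theorem reflectCoeff_apply (c : Fin m → ℝ) (k : Fin m) :
    reflectCoeff m c k = (-1) ^ ((k : ℕ) + 1) * c k := rfl

theorem dampingPoly_reflectCoeff (c : Fin m → ℝ) (x : ℝ) :
    dampingPoly (reflectCoeff m c) x = -dampingPoly c (-x) := by
  simp only [dampingPoly, reflectCoeff_apply, ← Finset.sum_neg_distrib]
  refine Finset.sum_congr rfl fun k _ => ?_
  rw [neg_pow x]
  ring

theorem scaledCoeff_reflectCoeff (c : Fin m → ℝ) (t : ℝ) :
    scaledCoeff (reflectCoeff m c) t = reflectCoeff m (scaledCoeff c t) :=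
  funext fun k => mul_assoc ((-1) ^ ((k : ℕ) + 1)) (c k) _

theorem norm_reflectCoeff (c : Fin m → ℝ) : ‖reflectCoeff m c‖ = ‖c‖ := by
  simp [Pi.norm_def, reflectCoeff_apply, nnnorm_mul]

end DampingPolynomials

section HalfTurns

variable {m : ℕ} {c : Fin m → ℝ} {u : ℝ → ℝ} {t : ℝ} {g : ℝ →ᵇ ℝ}

theorem halfTurnDefect_scaledCoeff_apply_eq_zero_iff {s : ℝ}
    (hq : |dampingPoly c (polarPoint (t + foldIntegral g s, foldAngle s)).1| ≤ 1 / 2) :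
    halfTurnDefect (scaledCoeff c t, g) s = 0 ↔
      g s = polarSlope (dampingPoly c) (t + foldIntegral g s, foldAngle s) := by
  set v := (t + foldIntegral g s, foldAngle s) with hv
  have hexpand : halfTurnDefect (scaledCoeff c t, g) s = g s - dampingPoly c (polarPoint v).1 *
      (cos v.2 ^ 2 + sin v.2 * cos v.2 * g s) := by
    rw [polarPoint, exp_add, mul_assoc, mul_comm (exp (foldIntegral g s)),
      ← dampingPoly_scaledCoeff, cos_foldAngle, dampingPoly, Finset.sum_mul, halfTurnDefect]
    simp [halfTurnTerm_apply, mul_assoc, hv]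
  have hspeed := (polarField_snd_mem_Icc hq).1
  rw [hexpand, polarSlope, eq_div_iff (by linarith), ← sub_eq_zero (b := (polarField _ v).1),
    polarField]
  ring_nf

theorem IsPolarOrbit.exists_halfTurnDefect_eq_zero (hu : IsPolarOrbit (dampingPoly c) u) {η : ℝ}
    (hη : η ≤ 1 / 2) (hq : ∀ s, |dampingPoly c (polarPoint (u s, s)).1| ≤ η) :
    ∃ G : ℝ →ᵇ ℝ, ‖G‖ ≤ 2 * η ∧ halfTurnDefect (scaledCoeff c (u 0), G) = 0 ∧
      foldIntegral G π = u π - u 0 := by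
  have hcont : Continuous fun s => polarSlope (dampingPoly c) (u s, s) :=
    continuous_polarSlope_comp (contDiff_dampingPoly c (n := 0)).continuous
      (hu.continuous.prodMk continuous_id) hu.abs_damping_le
  have hbound (s : ℝ) := abs_polarSlope_le hη (hq (foldAngle s))
  let G : ℝ →ᵇ ℝ := .ofNormedAddCommGroup _ (hcont.comp continuous_foldAngle) (2 * η) hbound
  have hint (s : ℝ) : foldIntegral G s = u (foldAngle s) - u 0 := by
    rw [foldIntegral_congr (f := fun s => polarSlope (dampingPoly c) (u s, s)) fun s hs => ?_]
    · exact intervalIntegral.integral_eq_sub_of_hasDerivAt (fun s _ => hu.hasDerivAt s)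
        (hcont.intervalIntegrable _ _)
    · simp [G, foldAngle_of_mem_Icc hs]
  refine ⟨G, BoundedContinuousFunction.norm_ofNormedAddCommGroup_le _ ?_ hbound, ?_, ?_⟩
  · exact mul_nonneg zero_le_two ((abs_nonneg _).trans (hq 0))
  · ext s
    have hrad : u 0 + foldIntegral G s = u (foldAngle s) := by rw [hint]; ring
    refine (halfTurnDefect_scaledCoeff_apply_eq_zero_iff ?_).2 ?_ <;> rw [hrad]
    · exact hu.abs_damping_le _
    · rfl
  · rw [hint, foldAngle_of_mem_Icc ⟨pi_pos.le, le_rfl⟩]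

theorem even_intervalIntegral_of_odd {f : ℝ → ℝ} (hf : Function.Odd f) :
    Function.Even fun s => ∫ σ in (0 : ℝ)..s, f σ := fun s => by
  have hcomp := intervalIntegral.integral_comp_neg (f := f) (a := 0) (b := s)
  simp only [hf _, neg_zero, intervalIntegral.integral_neg] at hcomp
  beta_reduce
  rw [intervalIntegral.integral_symm, ← hcomp, neg_neg]

theorem periodic_intervalIntegral_of_odd {f : ℝ → ℝ} (hcont : Continuous f)
    (hf : Function.Odd f) {T : ℝ} (hper : Function.Periodic f T) :
    Function.Periodic (fun s => ∫ σ in (0 : ℝ)..s, f σ) T := fun s => by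
  have hint (a b : ℝ) := hcont.intervalIntegrable (μ := MeasureTheory.volume) a b
  have hperiod : ∫ σ in s..s + T, f σ = 0 := by
    rw [hper.intervalIntegral_add_eq s (-(T / 2)), show -(T / 2) + T = T / 2 by ring,
      ← intervalIntegral.integral_interval_sub_left (hint 0 _) (hint 0 _),
      sub_eq_zero]
    exact (even_intervalIntegral_of_odd hf (T / 2)).symm
  beta_reduce
  rw [← intervalIntegral.integral_add_adjacent_intervals (hint 0 s) (hint s _), hperiod, add_zero]

theorem isPolarOrbit_of_halfTurnDefect_eq_zero (hodd : Function.Odd (dampingPoly c))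
    (hg : halfTurnDefect (scaledCoeff c t, g) = 0)
    (hq : ∀ s, |dampingPoly c (polarPoint (t + foldIntegral g s, s)).1| ≤ 1 / 2) :
    IsPolarOrbit (dampingPoly c) fun s => t + foldIntegral g s := by
  let slope : ℝ → ℝ := fun s => polarSlope (dampingPoly c) (t + foldIntegral g s, s)
  have hcont : Continuous slope :=
    continuous_polarSlope_comp (contDiff_dampingPoly c (n := 0)).continuous (by fun_prop) hq
  have hslope_odd : Function.Odd slope := fun s => by
    simp [slope, polarSlope, polarField, polarPoint, even_foldIntegral g s, hodd _, neg_div]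
  have hslope_periodic : Function.Periodic slope (2 * π) := fun s => by
    simp [slope, polarSlope, polarField, polarPoint, periodic_foldIntegral g s]
  have hslope : EqOn g slope (Icc 0 π) := fun s hs => by
    have hfold := foldAngle_of_mem_Icc hs
    have hiff := halfTurnDefect_scaledCoeff_apply_eq_zero_iff (c := c) (t := t) (g := g) (s := s)
    rw [hfold] at hiff
    exact (hiff (hq s)).1 (by simp [hg])
  have hprimitive (s : ℝ) : foldIntegral g s = ∫ σ in (0 : ℝ)..s, slope σ := by
    rw [foldIntegral_congr hslope]
    exact apply_foldAngle_of_even_of_periodic (even_intervalIntegral_of_odd hslope_odd)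
      (periodic_intervalIntegral_of_odd hcont hslope_odd hslope_periodic) s
  refine ⟨fun s => ?_, fun s => by rw [periodic_foldIntegral], hq⟩
  exact ((hcont.integral_hasStrictDerivAt 0 s).hasDerivAt.const_add t).congr_of_eventuallyEq
    (.of_forall fun s => congrArg (t + ·) (hprimitive s))

end HalfTurns

section ContinuousFamilies

variable {q : ℝ → ℝ} {v : ℝ → ℝ → ℝ} {t₀ : ℝ}

theorem eventually_polarOrbit_subset (hv : ∀ s, ContinuousAt (Function.uncurry v) (t₀, s))
    (hper : ∀ᶠ t in 𝓝 t₀, Function.Periodic (v t) (2 * π)) {V : Set (ℝ × ℝ)} (hV : IsOpen V)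
    (hsub : polarOrbit (v t₀) ⊆ V) : ∀ᶠ t in 𝓝 t₀, polarOrbit (v t) ⊆ V := by
  have hnear : ∀ᶠ t in 𝓝 t₀, ∀ s ∈ Icc 0 (2 * π), polarPoint (v t s, s) ∈ V := by
    refine isCompact_Icc.eventually_forall_of_forall_eventually fun s _ => ?_
    have hcont : ContinuousAt (fun z : ℝ × ℝ => polarPoint (v z.1 z.2, z.2)) (t₀, s) :=
      (contDiff_polarPoint (n := 0)).continuous.continuousAt.comp ((hv s).prodMk continuousAt_snd)
    exact hcont.eventually_mem (hV.mem_nhds (hsub ⟨s, rfl⟩))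
  filter_upwards [hper, hnear] with t hper hnear
  rintro _ ⟨s, rfl⟩
  have hper' : Function.Periodic (fun s => polarPoint (v t s, s)) (2 * π) := fun s => by
    simpa [hper s] using periodic_polarPoint (v t s, s)
  obtain ⟨s', hs', heq⟩ := hper'.exists_mem_Ico₀ two_pi_pos s
  exact mem_of_eq_of_mem heq (hnear s' (Ico_subset_Icc_self hs'))

theorem not_isLimitCycle_of_family (hq : ContDiff ℝ 1 q)
    (hv : ∀ s, ContinuousAt (Function.uncurry v) (t₀, s)) (hv₀ : ∀ t, v t 0 = t)
    (horbit : ∀ᶠ t in 𝓝 t₀, IsPolarOrbit q (v t)) :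
    ¬IsLimitCycle (dampedField q) (polarOrbit (v t₀)) := by
  rintro ⟨-, V, hV, hsub, hiso⟩
  have hconst : ∀ᶠ t in 𝓝 t₀, t = t₀ := by
    filter_upwards [horbit,
      eventually_polarOrbit_subset hv (horbit.mono fun _ ht => ht.periodic) hV hsub] with t ht htV
    have hmem : polarPoint (t, 0) ∈ polarOrbit (v t) :=
      (polarPoint_mem_polarOrbit_iff ht.periodic).2 (hv₀ t).symm
    rw [hiso _ (ht.isPeriodicOrbit hq) htV] at hmem
    rw [(polarPoint_mem_polarOrbit_iff horbit.self_of_nhds.periodic).1 hmem, hv₀]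
  obtain ⟨t, hne, heq⟩ := ((eventually_mem_nhdsWithin (s := {t₀}ᶜ)).and
    (nhdsWithin_le_nhds hconst)).exists
  exact hne heq

end ContinuousFamilies

/-- `γ` solves the half-turn equation for all coefficients of norm at most `δ`, uniquely among
the functions that arise as slopes of closed orbits, and `δ` is so small that the resulting
dampings do not exceed `1 / 2`. -/
structure IsHalfTurnSolution {m : ℕ} (δ : ℝ) (γ : (Fin m → ℝ) → (ℝ →ᵇ ℝ)) : Prop where
  continuousAt {p : Fin m → ℝ} (hp : ‖p‖ ≤ δ) : ContinuousAt γ p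
  halfTurnDefect_eq_zero {p : Fin m → ℝ} (hp : ‖p‖ ≤ δ) : halfTurnDefect (p, γ p) = 0
  norm_foldIntegral_le {p : Fin m → ℝ} (hp : ‖p‖ ≤ δ) : ‖foldIntegral (γ p)‖ ≤ 1
  eq_of_halfTurnDefect_eq_zero {p : Fin m → ℝ} {g : ℝ →ᵇ ℝ} (hp : ‖p‖ ≤ δ)
    (hg : ‖g‖ ≤ 2 * (m * δ)) (h : halfTurnDefect (p, g) = 0) : γ p = g
  small : m * (δ * 3 ^ m) ≤ 1 / 2

section HalfTurnSolutions

variable {m : ℕ} {c : Fin m → ℝ} {u : ℝ → ℝ} {t : ℝ}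

theorem eventually_forall_norm_le {E : Type*} [SeminormedAddCommGroup E] {p : E → Prop}
    (h : ∀ᶠ x in 𝓝 0, p x) : ∀ᶠ δ : ℝ in 𝓝 0, ∀ x, ‖x‖ ≤ δ → p x :=
  ((tendsto_closedBall_smallSets 0).eventually h.smallSets).mono fun _ hδ x hx =>
    hδ x (mem_closedBall_zero_iff.2 hx)

theorem eventually_isHalfTurnSolution {γ : (Fin m → ℝ) → (ℝ →ᵇ ℝ)} (hγ : ContDiffAt ℝ ω γ 0)
    (hγ₀ : γ 0 = 0)
    (hiff : ∀ᶠ x in 𝓝 (0 : (Fin m → ℝ) × (ℝ →ᵇ ℝ)), halfTurnDefect x = 0 ↔ γ x.1 = x.2) :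
    ∀ᶠ δ in 𝓝 0, IsHalfTurnSolution δ γ := by
  have hcont : ∀ᶠ p in 𝓝 0, ContinuousAt γ p :=
    (hγ.eventually (by simp)).mono fun _ hp => hp.continuousAt
  have hgraph : Tendsto (fun p => (p, γ p)) (𝓝 0) (𝓝 0) :=
    tendsto_id.prodMk_nhds (hγ₀ ▸ hγ.continuousAt.tendsto)
  have hbound : ∀ᶠ p in 𝓝 0, ‖foldIntegral (γ p)‖ < 1 :=
    (foldIntegral.continuous.continuousAt.comp hγ.continuousAt).norm.eventually_lt_const
      (by simp [hγ₀])
  have hsmall : ∀ᶠ δ : ℝ in 𝓝 0, m * (δ * 3 ^ m) < 1 / 2 :=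
    (by fun_prop : ContinuousAt (fun δ : ℝ => m * (δ * 3 ^ m)) 0).eventually_lt_const (by simp)
  have hradius : Tendsto (fun δ : ℝ => max δ (2 * (m * δ))) (𝓝 0) (𝓝 0) := by
    simpa using (by fun_prop : Continuous fun δ : ℝ => max δ (2 * (m * δ))).tendsto 0
  filter_upwards [eventually_forall_norm_le hcont,
    eventually_forall_norm_le (hgraph.eventually hiff), eventually_forall_norm_le hbound, hsmall,
    hradius.eventually (eventually_forall_norm_le hiff)] with δ hcont hzero hbound hsmall hunique
  exact
    { continuousAt := fun hp => hcont _ hp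
      halfTurnDefect_eq_zero := fun hp => (hzero _ hp).2 rfl
      norm_foldIntegral_le := fun hp => (hbound _ hp).le
      eq_of_halfTurnDefect_eq_zero := fun hp hg h =>
        (hunique (_, _) (norm_prod_le_iff.2 ⟨hp.trans (le_max_left _ _),
          hg.trans (le_max_right _ _)⟩)).1 h
      small := hsmall.le }

theorem abs_dampingPoly_le_of_abs_le_exp_mul {x X : ℝ} (hX : 1 ≤ X) (hx : |x| ≤ exp t * X) :
    |dampingPoly c x| ≤ m * (‖scaledCoeff c t‖ * X ^ m) := by
  have hscale : dampingPoly c x = dampingPoly (scaledCoeff c t) (exp (-t) * x) := by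
    rw [dampingPoly_scaledCoeff, ← mul_assoc, ← exp_add, add_neg_cancel, exp_zero, one_mul]
  rw [hscale]
  refine abs_dampingPoly_le _ hX ?_
  rwa [abs_mul, abs_exp, exp_neg, inv_mul_le_iff₀ (exp_pos t)]

theorem abs_dampingPoly_le_of_abs_le_exp {x : ℝ} (hx : |x| ≤ exp t) :
    |dampingPoly c x| ≤ m * ‖scaledCoeff c t‖ := by
  simpa using abs_dampingPoly_le_of_abs_le_exp_mul le_rfl (by rwa [mul_one])

theorem abs_fst_polarPoint_le (v : ℝ × ℝ) : |(polarPoint v).1| ≤ exp v.1 := by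
  rw [polarPoint, abs_mul, abs_exp]
  exact mul_le_of_le_one_right (exp_pos _).le (abs_sin_le_one _)

namespace IsHalfTurnSolution

variable {δ : ℝ} {γ : (Fin m → ℝ) → (ℝ →ᵇ ℝ)}

theorem mul_le_one_half (hγ : IsHalfTurnSolution δ γ) (hδ : 0 ≤ δ) : m * δ ≤ 1 / 2 := by
  refine le_trans ?_ hγ.small
  gcongr
  exact le_mul_of_one_le_right hδ (one_le_pow₀ (by norm_num))

theorem foldIntegral_pi_eq_sub (hγ : IsHalfTurnSolution δ γ) (ht : ‖scaledCoeff c t‖ ≤ δ)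
    (hu : IsPolarOrbit (dampingPoly c) u) (hut : ∀ s, u s ≤ t) :
    foldIntegral (γ (scaledCoeff c (u 0))) π = u π - u 0 := by
  have hdamp (s : ℝ) : |dampingPoly c (polarPoint (u s, s)).1| ≤ m * δ :=
    (abs_dampingPoly_le_of_abs_le_exp ((abs_fst_polarPoint_le _).trans
      (exp_le_exp.2 (hut s)))).trans (by gcongr)
  obtain ⟨g, hg, hzero, hpi⟩ := hu.exists_halfTurnDefect_eq_zero
    (hγ.mul_le_one_half ((norm_nonneg _).trans ht)) hdamp
  rw [hγ.eq_of_halfTurnDefect_eq_zero ((monotone_norm_scaledCoeff c (hut 0)).trans ht) hg hzero,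
    hpi]

theorem foldIntegral_pi_eq_reflectCoeff (hγ : IsHalfTurnSolution δ γ)
    (ht : ‖scaledCoeff c t‖ ≤ δ) (hu : IsPolarOrbit (dampingPoly c) u) (hut : ∀ s, u s ≤ t) :
    foldIntegral (γ (scaledCoeff c (u 0))) π =
      foldIntegral (γ (reflectCoeff m (scaledCoeff c (u 0)))) π := by
  have hu' := hu.comp_neg
  rw [← funext (dampingPoly_reflectCoeff c)] at hu'
  have hbackward := hγ.foldIntegral_pi_eq_sub (t := t)
    (by rwa [scaledCoeff_reflectCoeff, norm_reflectCoeff]) hu' fun s => hut (-s)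
  rw [neg_zero] at hbackward
  have hper : u π = u (-π) := by
    rw [← hu.periodic (-π)]
    congr 1
    ring
  rw [hγ.foldIntegral_pi_eq_sub ht hu hut, hper, ← scaledCoeff_reflectCoeff, hbackward]

theorem isPolarOrbit_of_odd (hγ : IsHalfTurnSolution δ γ) (hodd : Function.Odd (dampingPoly c))
    (ht : ‖scaledCoeff c t‖ ≤ δ) :
    IsPolarOrbit (dampingPoly c) fun s => t + foldIntegral (γ (scaledCoeff c t)) s := by
  refine isPolarOrbit_of_halfTurnDefect_eq_zero hodd (hγ.halfTurnDefect_eq_zero ht) fun s => ?_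
  have hrad : |(polarPoint (t + foldIntegral (γ (scaledCoeff c t)) s, s)).1| ≤ exp t * 3 := by
    refine (abs_fst_polarPoint_le _).trans ?_
    rw [exp_add]
    gcongr
    refine (exp_le_exp.2 ?_).trans exp_one_lt_three.le
    exact (le_abs_self _).trans (((foldIntegral _).norm_coe_le_norm s).trans
      (hγ.norm_foldIntegral_le ht))
  refine (abs_dampingPoly_le_of_abs_le_exp_mul (by norm_num) hrad).trans (le_trans ?_ hγ.small)
  gcongr

theorem not_isLimitCycle_of_odd (hγ : IsHalfTurnSolution δ γ)
    (hodd : Function.Odd (dampingPoly c)) (hu : IsPolarOrbit (dampingPoly c) u)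
    (hu₀ : ‖scaledCoeff c (u 0)‖ < δ) :
    ¬IsLimitCycle (dampedField (dampingPoly c)) (polarOrbit u) := by
  let v (t s : ℝ) : ℝ := t + foldIntegral (γ (scaledCoeff c t)) s
  have hv₀ (t : ℝ) : v t 0 = t := by
    simp [v, foldIntegral_apply, foldAngle_of_mem_Icc ⟨le_rfl, pi_pos.le⟩]
  have hscale : Continuous (scaledCoeff c) :=
    continuous_iff_continuousAt.2 fun t => (hasDerivAt_scaledCoeff c t).continuousAt
  have horbit : ∀ᶠ t in 𝓝 (u 0), IsPolarOrbit (dampingPoly c) (v t) :=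
    (hscale.norm.continuousAt.eventually_lt_const hu₀).mono fun t ht =>
      hγ.isPolarOrbit_of_odd hodd ht.le
  have hcont (s : ℝ) : ContinuousAt (Function.uncurry v) (u 0, s) := by
    have hsol : ContinuousAt (fun z : ℝ × ℝ => γ (scaledCoeff c z.1)) (u 0, s) :=
      ContinuousAt.comp (g := γ) (hγ.continuousAt hu₀.le)
        (hscale.comp continuous_fst).continuousAt
    exact continuousAt_fst.add
      ((foldIntegral.continuous.continuousAt.comp hsol).eval continuousAt_snd)
  have hq := contDiff_dampingPoly c (n := 1)
  have heq : polarOrbit (v (u 0)) = polarOrbit u :=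
    (horbit.self_of_nhds.isPeriodicOrbit hq).eq_of_mem (contDiff_dampedField hq)
      (hu.isPeriodicOrbit hq) (z := polarPoint (u 0, 0)) ⟨0, by simp only [hv₀]⟩ ⟨0, rfl⟩
  exact heq ▸ not_isLimitCycle_of_family hq hcont hv₀ horbit

end IsHalfTurnSolution

end HalfTurnSolutions

section LimitCycleCount

variable {m : ℕ} {γ : (Fin m → ℝ) → (ℝ →ᵇ ℝ)}

theorem sub_reflectCoeff_eq_sum (p : Fin m → ℝ) :
    p - reflectCoeff m p = ∑ k with Even (Fin.val k), p k • (2 : ℝ) • Pi.single k (1 : ℝ) := by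
  ext k
  rw [Finset.sum_filter, Pi.sub_apply, reflectCoeff_apply, Finset.sum_apply,
    Finset.sum_eq_single k (fun j _ hj => ?_) (by simp)]
  · rcases Nat.even_or_odd (k : ℕ) with hk | hk
    · simp [hk, pow_succ, mul_two]
    · simp [Nat.not_even_iff_odd.2 hk, hk.neg_one_pow, pow_succ]
  · split_ifs <;> simp [hj.symm]

theorem fderiv_foldIntegral_pi_single_pos (hγ : DifferentiableAt ℝ γ 0) (hγ₀ : γ 0 = 0)
    (h : ∀ᶠ p in 𝓝 0, halfTurnDefect (p, γ p) = 0) (k : Fin m) :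
    0 < fderiv ℝ (fun p => foldIntegral (γ p) π) 0 (Pi.single k 1) := by
  let endpoint : (ℝ →ᵇ ℝ) →L[ℝ] ℝ := BoundedContinuousFunction.evalCLM ℝ π ∘L foldIntegral
  have hderiv : HasFDerivAt (fun p => foldIntegral (γ p) π) (endpoint ∘L fderiv ℝ γ 0) 0 :=
    endpoint.hasFDerivAt.comp 0 hγ.hasFDerivAt
  have hcongr : EqOn (absSin ^ (k : ℕ) * boundedCos ^ 2 : ℝ →ᵇ ℝ)
      (fun s => sin s ^ (k : ℕ) * cos s ^ 2) (Icc 0 π) := fun s hs => by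
    change sin (foldAngle s) ^ (k : ℕ) * cos s ^ 2 = _
    rw [foldAngle_of_mem_Icc hs]
  rw [hderiv.fderiv, ContinuousLinearMap.comp_apply,
    fderiv_single_of_halfTurnDefect_eq_zero hγ hγ₀ h]
  change 0 < foldIntegral _ π
  rw [foldIntegral_congr hcongr, foldAngle_of_mem_Icc ⟨pi_pos.le, le_rfl⟩]
  exact integral_sin_pow_mul_cos_sq_pos k

theorem exists_foldIntegral_sub_reflectCoeff_eq_sum (hγ : ContDiffAt ℝ ω γ 0) (hγ₀ : γ 0 = 0)
    (h : ∀ᶠ p in 𝓝 0, halfTurnDefect (p, γ p) = 0) :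
    ∃ Ψ : Fin m → (Fin m → ℝ) → ℝ, (∀ k, ContDiffAt ℝ ∞ (Ψ k) 0) ∧ (∀ k, Ψ k 0 ≠ 0) ∧
      ∀ᶠ p in 𝓝 0, foldIntegral (γ p) π - foldIntegral (γ (reflectCoeff m p)) π =
        ∑ k with Even (Fin.val k), p k * Ψ k p := by
  let endpoint : (ℝ →ᵇ ℝ) →L[ℝ] ℝ := BoundedContinuousFunction.evalCLM ℝ π ∘L foldIntegral
  have hsmooth : ∀ᶠ p in 𝓝 0, ContDiffAt ℝ ∞ (fun p => foldIntegral (γ p) π) p :=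
    (hγ.eventually (by simp)).mono fun p hp =>
      endpoint.contDiff.contDiffAt.comp p (hp.of_le (by simp))
  obtain ⟨Φ, hΦ, hΦ₀, hsub⟩ := exists_sub_eq_clm_apply_sub hsmooth
  have hpair : ContDiff ℝ ∞ fun p : Fin m → ℝ => (p, reflectCoeff m p) :=
    contDiff_id.prodMk (reflectCoeff m).contDiff
  have hpair₀ : ((0 : Fin m → ℝ), reflectCoeff m 0) = (0, 0) := by rw [map_zero]
  refine ⟨fun k p => Φ (p, reflectCoeff m p) ((2 : ℝ) • Pi.single k 1), fun k => ?_,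
    fun k => ?_, ?_⟩
  · exact ContDiffAt.clm_apply (ContDiffAt.comp (g := Φ) 0 (hpair₀ ▸ hΦ) hpair.contDiffAt)
      contDiffAt_const
  · beta_reduce
    rw [hpair₀, hΦ₀, map_smul]
    exact smul_ne_zero two_ne_zero (fderiv_foldIntegral_pi_single_pos
      (hγ.differentiableAt (by simp)) hγ₀ h k).ne'
  · have htendsto : Tendsto (fun p => (p, reflectCoeff m p)) (𝓝 0) (𝓝 (0, 0)) :=
      hpair₀ ▸ hpair.continuous.tendsto 0
    filter_upwards [htendsto.eventually hsub] with p hp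
    rw [hp, sub_reflectCoeff_eq_sum, map_sum]
    exact Finset.sum_congr rfl fun k _ => map_smul _ _ _

theorem exists_isPolarOrbit_of_mem_limitCyclesIn {δ : ℝ} (hγ : IsHalfTurnSolution δ γ)
    {c : Fin m → ℝ} {t : ℝ} (ht : ‖scaledCoeff c t‖ ≤ δ) {Γ : Set (ℝ × ℝ)}
    (hΓ : Γ ∈ limitCyclesIn (dampedField (dampingPoly c)) (logDisc t)) :
    ∃ u, IsPolarOrbit (dampingPoly c) u ∧ Γ = polarOrbit u ∧ ∀ s, u s < t := by
  have hsmall : ∀ z ∈ Γ, |dampingPoly c z.1| ≤ 1 / 2 := fun z hz =>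
    (abs_dampingPoly_le_of_abs_le_exp (abs_fst_le_of_mem_logDisc (hΓ.2 hz))).trans <|
      le_trans (by gcongr) (hγ.mul_le_one_half ((norm_nonneg _).trans ht))
  obtain ⟨u, hu, rfl⟩ := hΓ.1.1.exists_isPolarOrbit (contDiff_dampingPoly c) hsmall
  exact ⟨u, hu, rfl, fun s => polarPoint_mem_logDisc_iff.1 (hΓ.2 ⟨s, rfl⟩)⟩

theorem limitCyclesIn_eq_empty_of_odd {δ : ℝ} (hγ : IsHalfTurnSolution δ γ) {c : Fin m → ℝ}
    (hodd : Function.Odd (dampingPoly c)) {t : ℝ} (ht : ‖scaledCoeff c t‖ < δ) :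
    limitCyclesIn (dampedField (dampingPoly c)) (logDisc t) = ∅ :=
  eq_empty_of_forall_notMem fun _ hΓ => by
    obtain ⟨u, hu, rfl, hut⟩ := exists_isPolarOrbit_of_mem_limitCyclesIn hγ ht.le hΓ
    exact hγ.not_isLimitCycle_of_odd hodd hu
      ((monotone_norm_scaledCoeff c (hut 0).le).trans_lt ht) hΓ.1

theorem encard_limitCyclesIn_le_encard_zeros {δ : ℝ} (hγ : IsHalfTurnSolution δ γ)
    {c : Fin m → ℝ} {t : ℝ} (ht : ‖scaledCoeff c t‖ ≤ δ) :
    (limitCyclesIn (dampedField (dampingPoly c)) (logDisc t)).encard ≤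
      {s ∈ Iio t | foldIntegral (γ (scaledCoeff c s)) π -
        foldIntegral (γ (reflectCoeff m (scaledCoeff c s))) π = 0}.encard := by
  choose! u hu hΓu hut using fun Γ hΓ => exists_isPolarOrbit_of_mem_limitCyclesIn hγ ht (Γ := Γ) hΓ
  have hmem {Γ} (hΓ : Γ ∈ limitCyclesIn (dampedField (dampingPoly c)) (logDisc t)) :
      polarPoint (u Γ 0, 0) ∈ Γ := by
    rw [hΓu Γ hΓ]
    exact ⟨0, by rw [← hΓu Γ hΓ]⟩
  refine encard_le_encard_of_injOn (f := fun Γ => u Γ 0) (fun Γ hΓ => ⟨hut Γ hΓ 0, ?_⟩)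
    fun Γ₁ h₁ Γ₂ h₂ heq => ?_
  · exact sub_eq_zero.2
      (hγ.foldIntegral_pi_eq_reflectCoeff ht (hu Γ hΓ) fun s => (hut Γ hΓ s).le)
  · refine h₁.1.1.eq_of_mem (contDiff_dampedField (contDiff_dampingPoly c)) h₂.1.1 (hmem h₁) ?_
    simp only at heq
    exact heq ▸ hmem h₂

theorem eventually_encard_scaledCoeff_zeros_lt_card {Ψ : Fin m → (Fin m → ℝ) → ℝ}
    (hΨ : ∀ k, ContDiffAt ℝ ∞ (Ψ k) 0) (hΨ₀ : ∀ k, Ψ k 0 ≠ 0) :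
    ∀ᶠ δ : ℝ in 𝓝 0, ∀ I : Finset (Fin m), I.Nonempty → ∀ (c : Fin m → ℝ) (t : ℝ),
      ‖scaledCoeff c t‖ ≤ δ → (∀ k ∈ I, c k ≠ 0) →
        {s ∈ Iio t | ∑ k ∈ I, scaledCoeff c s k * Ψ k (scaledCoeff c s) = 0}.encard < I.card := by
  refine eventually_all.2 fun I => ?_
  rcases I.eq_empty_or_nonempty with rfl | hI
  · simp
  have hbound := eventually_encard_zeros_lt_card (scalingGenerator m).contDiff.contDiffAt
    (map_zero _) hI (e := fun k => ((k : ℕ) : ℝ))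
    (fun _ _ _ _ hab => Fin.ext (Nat.cast_injective hab)) (fun k _ => hΨ k) (fun k _ => hΨ₀ k)
  filter_upwards [(tendsto_closedBall_smallSets 0).eventually hbound] with δ hδ _ c t ht hc
  simpa only [scaledCoeff, mul_assoc] using hδ (scaledCoeff c) (Iio t) c ordConnected_Iio
    (fun s _ => hasDerivAt_scaledCoeff c s)
    (fun s hs => mem_closedBall_zero_iff.2
      ((monotone_norm_scaledCoeff c (le_of_lt hs)).trans ht)) hc

theorem exists_encard_limitCyclesIn_logDisc_le (m : ℕ) :
    ∃ δ > 0, ∀ (c : Fin m → ℝ) (t : ℝ), ‖scaledCoeff c t‖ < δ →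
      (limitCyclesIn (dampedField (dampingPoly c)) (logDisc t)).encard ≤
        (({k | Even (k : ℕ) ∧ c k ≠ 0} : Finset (Fin m)).card - 1 : ℕ) := by
  obtain ⟨γ, hγ, hγ₀, hiff⟩ := exists_halfTurnDefect_eq_zero_iff m
  have hsol := eventually_isHalfTurnSolution hγ hγ₀ hiff
  have hzero : ∀ᶠ p in 𝓝 0, halfTurnDefect (p, γ p) = 0 :=
    ((tendsto_id.prodMk_nhds (hγ₀ ▸ hγ.continuousAt.tendsto)).eventually hiff).mono
      fun _ hp => hp.2 rfl
  obtain ⟨Ψ, hΨ, hΨ₀, hexpand⟩ := exists_foldIntegral_sub_reflectCoeff_eq_sum hγ hγ₀ hzero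
  obtain ⟨δ, ⟨hsol, hexpand, hcount⟩, hδ⟩ := (((hsol.and ((eventually_forall_norm_le hexpand).and
    (eventually_encard_scaledCoeff_zeros_lt_card hΨ hΨ₀))).filter_mono nhdsWithin_le_nhds).and
      (eventually_mem_nhdsWithin (s := Ioi 0))).exists
  refine ⟨δ, hδ, fun c t ht => ?_⟩
  set I : Finset (Fin m) := {k | Even (k : ℕ) ∧ c k ≠ 0} with hI
  rcases I.eq_empty_or_nonempty with hempty | hne
  · have hodd := odd_dampingPoly (c := c) (by simpa [hI, Finset.filter_eq_empty_iff] using hempty)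
    simp [limitCyclesIn_eq_empty_of_odd hsol hodd ht]
  · rw [← ENat.lt_natCast_add_one_iff, ← Nat.cast_add_one, Nat.sub_add_cancel hne.card_pos]
    refine (encard_limitCyclesIn_le_encard_zeros hsol ht.le).trans_lt ?_
    refine lt_of_eq_of_lt (congrArg encard (Set.ext fun s => and_congr_right fun hs => ?_))
      (hcount I hne c t ht.le (by simp [hI]))
    rw [hexpand _ ((monotone_norm_scaledCoeff c (le_of_lt hs)).trans ht.le), hI,
      ← Finset.filter_filter,
      Finset.sum_filter_of_ne (p := fun k => c k ≠ 0) fun k _ hk hck =>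
        hk (by simp [scaledCoeff, hck])]

end LimitCycleCount

section LienardFamilies

variable {d : ℕ}

theorem lienardField_eq_dampedField (a : ℝ) (lam : Fin d → ℝ) :
    lienardField a lam = dampedField (dampingPoly (Fin.cons a lam : Fin (d + 1) → ℝ)) := by
  funext z
  simp [lienardField, dampedField, dampingPoly, Fin.sum_univ_succ]

theorem tendsto_scaledCoeff_cons_zero (lam : Fin d → ℝ) :
    Tendsto (scaledCoeff (Fin.cons 0 lam : Fin (d + 1) → ℝ)) atBot (𝓝 0) := by
  refine tendsto_pi_nhds.2 fun k => Fin.cases ?_ (fun i => ?_) k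
  · simp [scaledCoeff]
  · have hexponent : Tendsto (fun t : ℝ => (i.succ : ℕ) * t) atBot atBot :=
      tendsto_id.const_mul_atBot (by simp only [Fin.val_succ]; positivity)
    simpa [scaledCoeff] using (tendsto_exp_atBot.comp hexponent).const_mul (lam i)

theorem exists_nhds_encard_limitCyclesIn_le (lam : Fin d → ℝ) :
    ∃ U ∈ 𝓝 (0 : ℝ × ℝ), ∃ W ∈ 𝓝 ((0 : ℝ), lam), ∀ p ∈ W,
      (limitCyclesIn (lienardField p.1 p.2) U).encard ≤
        (({k | Even (k : ℕ) ∧ (Fin.cons p.1 p.2 : Fin (d + 1) → ℝ) k ≠ 0} :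
          Finset (Fin (d + 1))).card - 1 : ℕ) := by
  obtain ⟨δ, hδ, hcount⟩ := exists_encard_limitCyclesIn_logDisc_le (d + 1)
  obtain ⟨t, ht⟩ := ((tendsto_zero_iff_norm_tendsto_zero.1
    (tendsto_scaledCoeff_cons_zero lam)).eventually_lt_const hδ).exists
  have hcont : Continuous fun p : ℝ × (Fin d → ℝ) =>
      scaledCoeff (Fin.cons p.1 p.2 : Fin (d + 1) → ℝ) t := by
    unfold scaledCoeff
    fun_prop
  refine ⟨logDisc t, logDisc_mem_nhds t, _, hcont.norm.continuousAt.eventually_lt_const ht,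
    fun p hp => ?_⟩
  rw [lienardField_eq_dampedField]
  exact hcount _ t hp

theorem exists_nhds_limitCyclesIn_eq_empty {a : ℝ} (ha : a ≠ 0) (lam : Fin d → ℝ) :
    ∃ U ∈ 𝓝 (0 : ℝ × ℝ), ∃ W ∈ 𝓝 (a, lam), ∀ p ∈ W,
      limitCyclesIn (lienardField p.1 p.2) U = ∅ := by
  have hcont : Continuous fun w : (ℝ × (Fin d → ℝ)) × (ℝ × ℝ) =>
      a * dampingPoly (Fin.cons w.1.1 w.1.2 : Fin (d + 1) → ℝ) w.2.1 := by
    unfold dampingPoly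
    fun_prop
  have hpos : ∀ᶠ w in 𝓝 (a, lam) ×ˢ 𝓝 (0 : ℝ × ℝ),
      0 < a * dampingPoly (Fin.cons w.1.1 w.1.2 : Fin (d + 1) → ℝ) w.2.1 := by
    rw [← nhds_prod_eq]
    refine hcont.continuousAt.eventually_const_lt ?_
    simpa [dampingPoly, Fin.sum_univ_succ] using mul_self_pos.2 ha
  obtain ⟨W, hW, U, hU, hWU⟩ := mem_prod_iff.1 hpos
  refine ⟨U, hU, W, hW, fun p hp => eq_empty_of_forall_notMem fun Γ hΓ => ?_⟩
  rw [lienardField_eq_dampedField] at hΓ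
  exact not_isPeriodicOrbit_dampedField (fun z hz => hWU (mk_mem_prod hp (hΓ.2 hz))) hΓ.1.1

theorem card_even_fin_le (d : ℕ) :
    ({k | Even (k : ℕ)} : Finset (Fin (d + 1))).card ≤ d / 2 + 1 := by
  rw [← Finset.card_range (d / 2 + 1)]
  refine Finset.card_le_card_of_injOn (fun k => k / 2) (fun k _ => ?_) fun j hj k hk hjk => ?_
  · simpa [Nat.lt_succ_iff] using Nat.div_le_div_right (c := 2) k.is_le
  · have hj' := (Finset.mem_filter.1 hj).2.two_dvd
    have hk' := (Finset.mem_filter.1 hk).2.two_dvd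
    exact Fin.ext (Nat.eq_of_mul_eq_mul_left two_pos (by grind))

theorem card_even_ne_zero_lt {c : Fin (d + 1) → ℝ} (hc : c 0 = 0) :
    ({k | Even (k : ℕ) ∧ c k ≠ 0} : Finset (Fin (d + 1))).card <
      ({k | Even (k : ℕ)} : Finset (Fin (d + 1))).card :=
  Finset.card_lt_card ((Finset.ssubset_iff_of_subset
    (Finset.monotone_filter_right _ fun _ _ => And.left)).2 ⟨0, by simp, by simp [hc]⟩)

end LienardFamilies

theorem theorem1p4 (d : ℕ) (lam : Fin d → ℝ) :
    (∃ U ∈ 𝓝 (0 : ℝ × ℝ), ∃ W ∈ 𝓝 lam, ∀ mu ∈ W,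
      (limitCyclesIn (lienardField 0 mu) U).encard ≤ ((d / 2 - 1 : ℕ) : ℕ∞)) ∧
    (∀ a : ℝ, ∃ U ∈ 𝓝 (0 : ℝ × ℝ), ∃ W ∈ 𝓝 (a, lam), ∀ p ∈ W,
      (limitCyclesIn (lienardField p.1 p.2) U).encard ≤ ((d / 2 : ℕ) : ℕ∞)) := by
  have hcard := card_even_fin_le d
  obtain ⟨U, hU, W, hW, hcount⟩ := exists_nhds_encard_limitCyclesIn_le lam
  refine ⟨⟨U, hU, _, (Continuous.prodMk_right (0 : ℝ)).continuousAt.preimage_mem_nhds hW,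
    fun mu hmu => (hcount (0, mu) hmu).trans (Nat.cast_le.2 ?_)⟩, fun a => ?_⟩
  · exact Nat.sub_le_sub_right (Nat.le_of_lt_succ
      ((card_even_ne_zero_lt (Fin.cons_zero _ _)).trans_le hcard)) 1
  · rcases eq_or_ne a 0 with rfl | ha
    · refine ⟨U, hU, W, hW, fun p hp => (hcount p hp).trans (Nat.cast_le.2 ?_)⟩
      exact Nat.sub_le_of_le_add
        ((Finset.card_le_card (Finset.monotone_filter_right _ fun _ _ => And.left)).trans hcard)
    · obtain ⟨U, hU, W, hW, hempty⟩ := exists_nhds_limitCyclesIn_eq_empty ha lam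
      exact ⟨U, hU, W, hW, fun p hp => by simp [hempty p hp]⟩
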